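/- Let $\mathcal A$ be a complete Boolean algebra with $0\neq 1$, and write $p(a)$ for the set of pairwise disjoint families $(a_i)\subseteq\mathcal A$ with $\bigvee a_i=a$ (members may be $0$). A *conditional set* $X=(X_a,\gamma_a)_{a\in\mathcal A}$ consists of sets $X_a$ and surjections $\gamma_a:X_1\to X_a$ such that $X_0$ is a singleton, $\gamma_1=\mathrm{id}$, $\gamma_b(x)=\gamma_b(y)$ and $a\le b$ imply $\gamma_a(x)=\gamma_a(y)$, and for all $(a_i)\in p(1)$ and $x_i\in X_{a_i}$ there is a unique $x\in X_1$ with $\gamma_{a_i}(x)=x_i$ for all $i$. We write $x\in X$ for $x\in X_1$. Products are formed componentwise. A *conditional function* $f:X\to Z$ is a family of functions $f_a:X_a\to Z_a$ with $f_a\circ\gamma_a=\gamma_a\circ f_1$ (equivalently, the graphs of the $f_a$ form a conditional subset of $X\times Z$); we write $f(x)$ for $f_1(x)$. A *conditional subset $Y$ of $X$ living on $1$*, $Y\in S(X)$, is a family of sets $Y_a\subseteq X_a$ which, with the restrictions of the maps $\gamma_a$, is a conditional set. For a non-empty set $E$, the conditional set *generated* by $E$ has as elements on $a$ the formal sums $\sum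 a_ie_i$ with $(a_i)\in p(a)$ and $e_i\in E$, where two sums are identified if for each $e\in E$ the suprema of the $a_i$ with $e_i=e$ coincide; $\gamma_a$ maps $\sum a_ie_i$ to $\sum(a\wedge a_i)e_i$. Operations and relations on $E$ are carried over to it conditionwise. Let $\mathbf N$ and $\mathbf Q$ be generated by $\mathbb N$ and $\mathbb Q$. The *conditional real numbers* $\mathbf R$ are the conditional functions $(q_n):\mathbf N\to\mathbf Q$ that are conditionally Cauchy (for every $\varepsilon\in\mathbf Q$, $\varepsilon>0$, there is $n_0\in\mathbf N$ with $|q_n-q_m|<\varepsilon$ for all $m,n\ge n_0$ in $\mathbf N$), where on the condition $a$ two sequences are identified if their difference converges conditionally to $0$ on $a$. Addition and multiplication are pointwise, and $[(p_n)]\le[(q_n)]$ if and only if for every $\varepsilon\in\mathbf Q$, $\varepsilon>0$, there is $n_0\in\mathbf N$ with $q_n-p_n>-\varepsilon$ for all $n\ge n_0$. A *conditional vector space* is a conditional set $X$ with conditional functions $+:X\times X\to X$ and $\cdot:\mathbf R\times X\to X$ that make $X_1$ a module over the ring $\mathbf R_1$. A *conditional subspace* of $X$ is a $Y\in S(X)$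 with $x+y\in Y$ and $\lambda x\in Y$ for all $x,y\in Y$, $\lambda\in\mathbf R$. A conditional function $f:X\to\mathbf R$ is *conditionally linear* if $f(x+y)=f(x)+f(y)$ and $f(\lambda x)=\lambda f(x)$ for all $x,y\in X$, $\lambda\in\mathbf R$; it is *conditionally convex* if $f(\lambda x+(1-\lambda)y)\le\lambda f(x)+(1-\lambda)f(y)$ for all $x,y\in X$ and $\lambda\in\mathbf R$ with $0\le\lambda\le1$. **Theorem (conditional Hahn–Banach theorem).** Let $X$ be a conditional vector space, $k:X\to\mathbf R$ a conditionally convex function, $Y\in S(X)$ a conditional subspace of $X$, and $f:Y\to\mathbf R$ a conditionally linear function such that $f(y)\le k(y)$ for every $y\in Y$. Then there exists a conditionally linear function $\hat f:X\to\mathbf R$ such that $\hat f(x)\le k(x)$ for every $x\in X$ and $\hat f(y)=f(y)$ for all $y\in Y$. -/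

import Mathlib

noncomputable section

/-- `(c i)` belongs to `p(a)`: a pairwise disjoint family (members may be `⊥`) with supremum `a`. -/
def IsPartition {A : Type*} [CompleteBooleanAlgebra A] {ι : Type*} (a : A) (c : ι → A) : Prop :=
  Pairwise (fun i j => Disjoint (c i) (c j)) ∧ ⨆ i, c i = a

/-- A conditional set on `A`: sets `X_a` and maps `γ_a : X_1 → X_a` (here `obj a` and `res a`).
A disjoint family has at most one index with a given nonzero member, and `X_0` is a singleton,
so that indexing partitions by types in the universe of `A` is no restriction. -/
structure CondSet.{u, v} (A : Type u) [CompleteBooleanAlgebra A] where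
  obj : A → Type v
  res : ∀ a, obj ⊤ → obj a
  bot_singleton : ∃ x : obj ⊥, ∀ y, y = x
  res_surjective : ∀ a, Function.Surjective (res a)
  res_top : ∀ x, res ⊤ x = x
  consistency : ∀ {a b : A}, a ≤ b → ∀ x y, res b x = res b y → res a x = res a y
  stability : ∀ {ι : Type u} (c : ι → A), IsPartition ⊤ c → ∀ x : (∀ i, obj (c i)),
    ∃! z : obj ⊤, ∀ i, res (c i) z = x i

/-- A conditional function `f : X → Y` as the family of its maps `f_a : X_a → Y_a`. The stated
compatibility says that the graphs of the `f_a` form a conditional subset of `X × Y`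
(see `CondFun.graph_stable`). -/
@[ext]
structure CondFun.{u, v, w} {A : Type u} [CompleteBooleanAlgebra A]
    (X : CondSet.{u, v} A) (Y : CondSet.{u, w} A) where
  app : ∀ a, X.obj a → Y.obj a
  natural : ∀ a x, app a (X.res a x) = Y.res a (app ⊤ x)

/-- A conditional function is applied to a conditional element of `X` (living on `1`) through its
primal part `f_1 : X_1 → Y_1`. -/
instance {A : Type*} [CompleteBooleanAlgebra A] (X Y : CondSet A) :
    CoeFun (CondFun X Y) (fun _ => X.obj ⊤ → Y.obj ⊤) := ⟨fun f => f.app ⊤⟩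

section Basic

universe u v w

variable {A : Type u} [CompleteBooleanAlgebra A]

/-- A conditional function commutes with amalgamations: its graph is a stable set. -/
theorem CondFun.graph_stable {X : CondSet.{u, v} A} {Y : CondSet.{u, w} A} (f : CondFun X Y)
    {ι : Type u} {c : ι → A} (hc : IsPartition ⊤ c) (x : X.obj ⊤) (y : Y.obj ⊤)
    (h : ∀ i, Y.res (c i) y = f.app (c i) (X.res (c i) x)) : y = f x := by
  refine (Y.stability c hc fun i => f.app (c i) (X.res (c i) x)).unique h fun i => ?_
  rw [f.natural]

/-- The conditional function with a given primal part. -/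
def CondFun.ofPrimal {X : CondSet.{u, v} A} {Y : CondSet.{u, w} A} (f : X.obj ⊤ → Y.obj ⊤)
    (hf : ∀ a x y, X.res a x = X.res a y → Y.res a (f x) = Y.res a (f y)) : CondFun X Y where
  app a x := Y.res a (f (Function.surjInv (X.res_surjective a) x))
  natural a x := by
    have h1 : Y.res a (f (Function.surjInv (X.res_surjective a) (X.res a x))) = Y.res a (f x) :=
      hf a _ _ (Function.surjInv_eq (X.res_surjective a) _)
    have h2 : Function.surjInv (X.res_surjective ⊤) x = x := by
      have := Function.surjInv_eq (X.res_surjective ⊤) x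
      rwa [X.res_top] at this
    rw [h1, h2, Y.res_top]

theorem CondFun.ofPrimal_apply {X : CondSet.{u, v} A} {Y : CondSet.{u, w} A}
    (f : X.obj ⊤ → Y.obj ⊤)
    (hf : ∀ a x y, X.res a x = X.res a y → Y.res a (f x) = Y.res a (f y)) (x : X.obj ⊤) :
    CondFun.ofPrimal f hf x = f x := by
  have h2 : Function.surjInv (X.res_surjective ⊤) x = x := by
    have := Function.surjInv_eq (X.res_surjective ⊤) x
    rwa [X.res_top] at this
  change Y.res ⊤ (f (Function.surjInv (X.res_surjective ⊤) x)) = f x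
  rw [h2, Y.res_top]

theorem CondFun.congr_res {X : CondSet.{u, v} A} {Y : CondSet.{u, w} A} (f : CondFun X Y) (a : A)
    {x y : X.obj ⊤} (h : X.res a x = X.res a y) : Y.res a (f x) = Y.res a (f y) := by
  rw [← f.natural, ← f.natural, h]

/-- The conditional product of two conditional sets. -/
def CondSet.prod (X : CondSet.{u, v} A) (Y : CondSet.{u, w} A) : CondSet.{u, max v w} A where
  obj a := X.obj a × Y.obj a
  res a p := (X.res a p.1, Y.res a p.2)
  bot_singleton := by
    obtain ⟨x, hx⟩ := X.bot_singleton
    obtain ⟨y, hy⟩ := Y.bot_singleton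
    exact ⟨(x, y), fun p => Prod.ext (hx p.1) (hy p.2)⟩
  res_surjective a p := by
    obtain ⟨x, hx⟩ := X.res_surjective a p.1
    obtain ⟨y, hy⟩ := Y.res_surjective a p.2
    exact ⟨(x, y), Prod.ext hx hy⟩
  res_top p := Prod.ext (X.res_top _) (Y.res_top _)
  consistency h p q hpq := Prod.ext (X.consistency h _ _ (congrArg Prod.fst hpq))
    (Y.consistency h _ _ (congrArg Prod.snd hpq))
  stability c hc p := by
    obtain ⟨x, hx, hx'⟩ := X.stability c hc fun i => (p i).1
    obtain ⟨y, hy, hy'⟩ := Y.stability c hc fun i => (p i).2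
    refine ⟨(x, y), fun i => Prod.ext (hx i) (hy i), fun z hz => Prod.ext ?_ ?_⟩
    · exact hx' _ fun i => congrArg Prod.fst (hz i)
    · exact hy' _ fun i => congrArg Prod.snd (hz i)

/-- A conditional subset `Y ∈ S(X)` living on `1`: sets `Y_a ⊆ X_a` which, with the restricted
maps `γ_a`, form a conditional set. -/
structure CondSubset (X : CondSet.{u, v} A) where
  carrier : ∀ a, Set (X.obj a)
  nonempty : (carrier ⊤).Nonempty
  carrier_eq : ∀ a, carrier a = X.res a '' carrier ⊤
  stable : ∀ {ι : Type u} (c : ι → A), IsPartition ⊤ c → ∀ x : X.obj ⊤,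
    (∀ i, X.res (c i) x ∈ carrier (c i)) → x ∈ carrier ⊤

/-- A conditional subset living on `1`, as a conditional set. -/
def CondSubset.toCondSet {X : CondSet.{u, v} A} (Y : CondSubset X) : CondSet.{u, v} A where
  obj a := Y.carrier a
  res a y := ⟨X.res a y.1, by rw [Y.carrier_eq a]; exact ⟨y.1, y.2, rfl⟩⟩
  bot_singleton := by
    obtain ⟨x, hx⟩ := X.bot_singleton
    obtain ⟨y, hy⟩ := Y.nonempty
    have hm : X.res ⊥ y ∈ Y.carrier ⊥ := by rw [Y.carrier_eq ⊥]; exact ⟨y, hy, rfl⟩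
    exact ⟨⟨_, hm⟩, fun z => Subtype.ext ((hx _).trans (hx _).symm)⟩
  res_surjective a y := by
    obtain ⟨y, hy⟩ := y
    have hy' := hy
    rw [Y.carrier_eq a] at hy'
    obtain ⟨x, hx, hxy⟩ := hy'
    exact ⟨⟨x, hx⟩, Subtype.ext hxy⟩
  res_top y := Subtype.ext (X.res_top _)
  consistency h x y hxy := Subtype.ext (X.consistency h _ _ (congrArg Subtype.val hxy))
  stability c hc x := by
    obtain ⟨z, hz, hz'⟩ := X.stability c hc fun i => (x i).1
    refine ⟨⟨z, Y.stable c hc z fun i => ?_⟩, fun i => Subtype.ext (hz i), fun w hw => ?_⟩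
    · rw [hz i]; exact (x i).2
    · exact Subtype.ext (hz' _ fun i => congrArg Subtype.val (hw i))

/-- A conditional ring: conditional operations `+` and `·` on `K` that make the primal set `K_1`
a classical ring. -/
class CondRing (K : CondSet.{u, v} A) extends Ring (K.obj ⊤) where
  add_cond : ∃ F : CondFun (K.prod K) K, ∀ x y : K.obj ⊤, F (x, y) = x + y
  mul_cond : ∃ F : CondFun (K.prod K) K, ∀ x y : K.obj ⊤, F (x, y) = x * y

/-- A conditional `K`-module (a conditional `K`-vector space if `K` is a conditional field):
conditional operations `+ : X × X → X` and `· : K × X → X` that make the primal set `X_1` a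
classical `K_1`-module. -/
class CondModule (K : CondSet.{u, w} A) [CondRing K] (X : CondSet.{u, v} A) extends
    AddCommGroup (X.obj ⊤), Module (K.obj ⊤) (X.obj ⊤) where
  add_cond : ∃ F : CondFun (X.prod X) X, ∀ x y : X.obj ⊤, F (x, y) = x + y
  smul_cond : ∃ F : CondFun (K.prod X) X, ∀ (l : K.obj ⊤) (x : X.obj ⊤), F (l, x) = l • x

/-- A conditional subspace: `Y + Y ⊑ Y` and `l Y ⊑ Y` for every `l ∈ K`. -/
structure CondSubspace (K : CondSet.{u, w} A) [CondRing K] (X : CondSet.{u, v} A)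
    [CondModule K X] extends CondSubset X where
  add_mem : ∀ x ∈ carrier ⊤, ∀ y ∈ carrier ⊤, x + y ∈ carrier ⊤
  smul_mem : ∀ (l : K.obj ⊤), ∀ x ∈ carrier ⊤, l • x ∈ carrier ⊤

variable {K : CondSet.{u, w} A} [CondRing K] {X : CondSet.{u, v} A} [CondModule K X]

/-- The primal set of a conditional subspace, as a classical submodule. -/
def CondSubspace.toSubmodule (Y : CondSubspace K X) : Submodule (K.obj ⊤) (X.obj ⊤) where
  carrier := Y.carrier ⊤
  add_mem' hx hy := Y.add_mem _ hx _ hy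
  zero_mem' := by
    obtain ⟨y, hy⟩ := Y.nonempty
    have := Y.smul_mem 0 y hy
    rwa [zero_smul] at this
  smul_mem' l _ hx := Y.smul_mem l _ hx

instance (Y : CondSubspace K X) : AddCommGroup (Y.toCondSet.obj ⊤) :=
  inferInstanceAs (AddCommGroup Y.toSubmodule)

instance (Y : CondSubspace K X) : Module (K.obj ⊤) (Y.toCondSet.obj ⊤) :=
  inferInstanceAs (Module (K.obj ⊤) Y.toSubmodule)

/-- A conditional subspace is a conditional `K`-module with the restricted operations. -/
instance (Y : CondSubspace K X) : CondModule K Y.toCondSet where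
  add_cond := by
    obtain ⟨F, hF⟩ := CondModule.add_cond (K := K) (X := X)
    refine ⟨CondFun.ofPrimal (fun p => p.1 + p.2) ?_, fun x y => CondFun.ofPrimal_apply _ _ _⟩
    intro a p q h
    refine Subtype.ext ?_
    change X.res a (p.1.1 + p.2.1) = X.res a (q.1.1 + q.2.1)
    rw [← hF, ← hF]
    refine F.congr_res a (Prod.ext ?_ ?_)
    · exact congrArg Subtype.val (congrArg Prod.fst h)
    · exact congrArg Subtype.val (congrArg Prod.snd h)
  smul_cond := by
    obtain ⟨F, hF⟩ := CondModule.smul_cond (K := K) (X := X)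
    refine ⟨CondFun.ofPrimal (fun p => p.1 • p.2) ?_, fun x y => CondFun.ofPrimal_apply _ _ _⟩
    intro a p q h
    refine Subtype.ext ?_
    change X.res a (p.1 • p.2.1) = X.res a (q.1 • q.2.1)
    rw [← hF, ← hF]
    refine F.congr_res a (Prod.ext ?_ ?_)
    · exact congrArg (fun z => z.1) h
    · exact congrArg (fun z => z.2.1) h

/-- A conditionally linear function `f : X → K`. -/
def IsCondLinear (f : CondFun X K) : Prop :=
  (∀ x y : X.obj ⊤, f (x + y) = f x + f y) ∧
    ∀ (l : K.obj ⊤) (x : X.obj ⊤), f (l • x) = l * f x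

/-- A conditionally convex function `f : X → K`, for a conditional ring `K` with an order. -/
def IsCondConvex [LE (K.obj ⊤)] (f : CondFun X K) : Prop :=
  ∀ (x y : X.obj ⊤) (l : K.obj ⊤), 0 ≤ l → l ≤ 1 →
    f (l • x + (1 - l) • y) ≤ l * f x + (1 - l) * f y

end Basic

/-! The conditional set generated by a classical set. -/

section Gen

universe u v w

variable (A : Type u) [CompleteBooleanAlgebra A]

theorem IsPartition.le {A : Type u} [CompleteBooleanAlgebra A] {ι : Type v} {c : ι → A}
    {a : A} (hc : IsPartition a c) (i : ι) : c i ≤ a := hc.2 ▸ le_iSup c i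

theorem iSup_inf_of_partition {A : Type u} [CompleteBooleanAlgebra A] {ι : Type v} {c : ι → A}
    {a : A} (hc : IsPartition a c) (b : A) (hb : b ≤ a) : ⨆ i, b ⊓ c i = b := by
  rw [← inf_iSup_eq, hc.2, inf_eq_left.2 hb]

theorem exists_inf_ne_bot {A : Type u} [CompleteBooleanAlgebra A] {ι : Type v} {c : ι → A}
    {a : A} (hc : IsPartition a c) {b : A} (hb : b ≤ a) (h : b ≠ ⊥) : ∃ i, b ⊓ c i ≠ ⊥ := by
  by_contra! hcon
  apply h
  rw [← iSup_inf_of_partition hc b hb]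
  simp [hcon]

theorem eq_of_le_partition {A : Type u} [CompleteBooleanAlgebra A] {ι : Type v} {c : ι → A}
    {a b : A} (hc : IsPartition a c) (h : b ≠ ⊥) {i j : ι} (hi : b ≤ c i) (hj : b ≤ c j) :
    i = j := by
  by_contra hij
  exact h (le_bot_iff.1 ((hc.1 hij) hi hj))

theorem partition_ext {A : Type u} [CompleteBooleanAlgebra A] {E : Type v} {x y : E → A} {a : A}
    (hx : IsPartition a x) (hy : IsPartition a y)
    (h : ∀ b, b ≠ ⊥ → ∀ e e', b ≤ x e → b ≤ y e' → e = e') : x = y := by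
  have key : ∀ {x y : E → A}, IsPartition a x → IsPartition a y →
      (∀ b, b ≠ ⊥ → ∀ e e', b ≤ x e → b ≤ y e' → e = e') → ∀ e, x e ≤ y e := by
    intro x y hx hy h e
    rw [← iSup_inf_of_partition hy (x e) (hx.le e)]
    refine iSup_le fun e' => ?_
    by_cases hb : x e ⊓ y e' = ⊥
    · rw [hb]; exact bot_le
    · rw [h _ hb e e' inf_le_left inf_le_right]; exact inf_le_right
  funext e
  exact le_antisymm (key hx hy h e) (key hy hx (fun b hb e e' h1 h2 => (h b hb e' e h2 h1).symm) e)

/-- The conditional set generated by a non-empty set `E`. A formal sum `∑ a_i x_i` with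
`(a_i) ∈ p(a)`, up to the identification of two such sums, is the same thing as the family
`z ↦ ⋁ {a_i : x_i = z}` in `p(a)` indexed by `E`; the latter is taken as the element. -/
def gen (E : Type v) [Nonempty E] : CondSet.{u, max u v} A where
  obj a := {x : E → A // IsPartition a x}
  res a x := ⟨fun e => a ⊓ x.1 e, fun i j hij => (x.2.1 hij).mono inf_le_right inf_le_right,
    iSup_inf_of_partition x.2 a le_top⟩
  bot_singleton := by
    have : ∀ x y : {x : E → A // IsPartition ⊥ x}, x = y := by
      intro x y
      refine Subtype.ext (partition_ext x.2 y.2 fun b hb e e' h1 _ => ?_)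
      refine absurd (le_bot_iff.1 (h1.trans (x.2.le e))) hb
    exact ⟨⟨fun _ => ⊥, fun _ _ _ => disjoint_bot_left, by simp⟩, fun y => this _ _⟩
  res_surjective a x := by
    classical
    obtain ⟨e₀⟩ := ‹Nonempty E›
    have hle : ∀ e, x.1 e ≤ a := x.2.le
    refine ⟨⟨fun e => x.1 e ⊔ (if e = e₀ then aᶜ else ⊥), ?_, ?_⟩, ?_⟩
    · intro i j hij
      have hd : ∀ e, Disjoint (x.1 e) aᶜ := fun e => disjoint_compl_right.mono_left (hle e)
      refine disjoint_sup_left.2 ⟨disjoint_sup_right.2 ⟨x.2.1 hij, ?_⟩,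
        disjoint_sup_right.2 ⟨?_, ?_⟩⟩
      · split_ifs
        · exact hd i
        · exact disjoint_bot_right
      · split_ifs
        · exact (hd j).symm
        · exact disjoint_bot_left
      · by_cases h1 : i = e₀
        · rw [if_neg (fun h2 : j = e₀ => hij (h1.trans h2.symm))]
          exact disjoint_bot_right
        · rw [if_neg h1]; exact disjoint_bot_left
    · have h : (⨆ e, if e = e₀ then aᶜ else ⊥) = aᶜ :=
        le_antisymm (iSup_le fun e => by split_ifs <;> simp) (le_iSup_of_le e₀ (by rw [if_pos rfl]))
      rw [iSup_sup_eq, x.2.2, h, sup_compl_eq_top]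
    · refine Subtype.ext (funext fun e => ?_)
      change a ⊓ (x.1 e ⊔ (if e = e₀ then aᶜ else ⊥)) = x.1 e
      rw [inf_sup_left, inf_eq_right.2 (hle e)]
      split_ifs <;> simp
  res_top x := Subtype.ext (funext fun e => top_inf_eq (x.1 e))
  consistency {a b} h x y hxy := by
    refine Subtype.ext (funext fun e => ?_)
    have := congrFun (congrArg Subtype.val hxy) e
    change b ⊓ x.1 e = b ⊓ y.1 e at this
    change a ⊓ x.1 e = a ⊓ y.1 e
    rw [← inf_eq_left.2 h, inf_assoc, this, inf_assoc]
  stability {ι} c hc x := by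
    have hle : ∀ i e, (x i).1 e ≤ c i := fun i => (x i).2.le
    have hz : IsPartition (⊤ : A) (fun e => ⨆ i, (x i).1 e) := by
      refine ⟨fun e e' hee => ?_, ?_⟩
      · simp only [disjoint_iSup_iff, iSup_disjoint_iff]
        intro i j
        by_cases hij : i = j
        · subst hij; exact (x i).2.1 hee
        · exact (hc.1 (Ne.symm hij)).mono (hle _ _) (hle _ _)
      · rw [iSup_comm]
        simp only [fun i => (x i).2.2]
        exact hc.2
    refine ⟨⟨_, hz⟩, fun i => Subtype.ext (funext fun e => ?_), fun w hw => ?_⟩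
    · change c i ⊓ (⨆ j, (x j).1 e) = (x i).1 e
      rw [inf_iSup_eq]
      refine le_antisymm (iSup_le fun j => ?_) ?_
      · by_cases hij : i = j
        · subst hij; exact inf_le_right
        · have : c i ⊓ (x j).1 e ≤ ⊥ := (hc.1 hij) inf_le_left (inf_le_right.trans (hle _ _))
          exact this.trans bot_le
      · exact le_iSup_of_le i (le_inf (hle i e) le_rfl)
    · refine Subtype.ext (funext fun e => ?_)
      change w.1 e = ⨆ i, (x i).1 e
      rw [← iSup_inf_of_partition hc (w.1 e) le_top]
      refine iSup_congr fun i => ?_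
      rw [← hw i, inf_comm]

end Gen

namespace Gen

universe u v w

variable {A : Type u} [CompleteBooleanAlgebra A] {E : Type v} [Nonempty E] {F : Type w}
  [Nonempty F]

/-- `coeff x e` is the largest condition on which `x` has the value `e`. -/
def coeff {a : A} (x : (gen A E).obj a) (e : E) : A := x.1 e

/-- The conditional relation generated by a classical relation `r`: the sums `∑ a_i x_i` and
`∑ b_j y_j` are related if `r x_i y_j` whenever `a_i ∧ b_j ≠ 0`. -/
def Rel (r : E → F → Prop) {a : A} (x : (gen A E).obj a) (y : (gen A F).obj a) : Prop :=
  ∀ e e', coeff x e ⊓ coeff y e' ≠ ⊥ → r e e'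

/-- The conditional element of the generated set given by a classical element. -/
def pure (A : Type u) [CompleteBooleanAlgebra A] (e : E) : (gen A E).obj ⊤ :=
  ⟨fun e' => ⨆ _ : e = e', ⊤, by
    refine ⟨fun i j hij => ?_, ?_⟩
    · by_cases h : e = i
      · have : e ≠ j := fun h' => hij (h.symm.trans h')
        simp [this]
      · simp [h]
    · exact top_le_iff.1 (le_iSup_of_le e (by simp))⟩

/-- The (primal part of the) conditional function generated by a classical function:
`∑ a_i x_i ↦ ∑ a_i f(x_i)`. -/
def map (f : E → F) (x : (gen A E).obj ⊤) : (gen A F).obj ⊤ :=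
  ⟨fun g => ⨆ (e : E) (_ : f e = g), coeff x e, by
    refine ⟨fun i j hij => ?_, ?_⟩
    · simp only [disjoint_iSup_iff, iSup_disjoint_iff]
      intro e he e' he'
      refine x.2.1 fun h => hij ?_
      subst h
      exact (by first | exact he.symm.trans he' | exact he'.symm.trans he)
    · rw [iSup_comm, eq_top_iff]
      have := x.2.2
      conv_lhs => rw [← this]
      exact iSup_mono fun e => le_iSup_of_le (f e) (le_iSup_of_le rfl le_rfl)⟩

/-- The (primal part of the) conditional function generated by a classical function of two
variables: `(∑ a_i x_i, ∑ b_j y_j) ↦ ∑ (a_i ∧ b_j) f(x_i, y_j)`. -/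
def map₂ {G : Type*} [Nonempty G] (f : E → F → G) (x : (gen A E).obj ⊤) (y : (gen A F).obj ⊤) :
    (gen A G).obj ⊤ :=
  map (fun p : E × F => f p.1 p.2) ⟨fun p => coeff x p.1 ⊓ coeff y p.2, by
    refine ⟨fun p q hpq => ?_, ?_⟩
    · by_cases h : p.1 = q.1
      · have h2 : p.2 ≠ q.2 := fun h' => hpq (Prod.ext h h')
        exact (y.2.1 h2).mono inf_le_right inf_le_right
      · exact (x.2.1 h).mono inf_le_left inf_le_left
    · rw [iSup_prod]
      have h1 : ∀ e, ⨆ e', coeff x e ⊓ coeff y e' = coeff x e := fun e =>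
        iSup_inf_of_partition y.2 _ le_top
      simp only [h1]
      exact x.2.2⟩

theorem le_coeff_pure (c : A) (e : E) : c ≤ coeff (pure A e) e := by
  simp [coeff, pure]

theorem le_coeff_map (f : E → F) {x : (gen A E).obj ⊤} {c : A} {e : E} (h : c ≤ coeff x e) :
    c ≤ coeff (map f x) (f e) :=
  h.trans (le_iSup_of_le e (le_iSup_of_le rfl le_rfl))

theorem le_coeff_map₂ {G : Type*} [Nonempty G] (f : E → F → G) {x : (gen A E).obj ⊤}
    {y : (gen A F).obj ⊤} {c : A} {e : E} {e' : F} (h : c ≤ coeff x e) (h' : c ≤ coeff y e') :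
    c ≤ coeff (map₂ f x y) (f e e') :=
  le_coeff_map (fun p : E × F => f p.1 p.2) (e := (e, e')) (le_inf h h')

theorem eq_of_le {x : (gen A E).obj ⊤} {c : A} (hc : c ≠ ⊥) {e e' : E} (h : c ≤ coeff x e)
    (h' : c ≤ coeff x e') : e = e' := eq_of_le_partition x.2 hc h h'

theorem exists_dec (x : (gen A E).obj ⊤) {b : A} (hb : b ≠ ⊥) :
    ∃ c, c ≤ b ∧ c ≠ ⊥ ∧ ∃ e, c ≤ coeff x e := by
  obtain ⟨e, he⟩ := exists_inf_ne_bot x.2 le_top hb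
  exact ⟨_, inf_le_left, he, e, inf_le_right⟩

theorem res_eq_iff {b : A} {x y : (gen A E).obj ⊤} : (gen A E).res b x = (gen A E).res b y ↔
    ∀ c ≤ b, c ≠ ⊥ → ∀ e e', c ≤ coeff x e → c ≤ coeff y e' → e = e' := by
  constructor
  · intro h c hcb hc e e' h1 h2
    have := congrFun (congrArg Subtype.val h) e
    change b ⊓ coeff x e = b ⊓ coeff y e at this
    refine eq_of_le hc (x := y) ?_ h2
    exact ((le_inf hcb h1).trans this.le).trans inf_le_right
  · intro h
    refine Subtype.ext (partition_ext ((gen A E).res b x).2 ((gen A E).res b y).2 ?_)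
    intro c hc e e' h1 h2
    exact h c (h1.trans inf_le_left) hc e e' (h1.trans inf_le_right) (h2.trans inf_le_right)

theorem le_coeff_congr {b : A} {x y : (gen A E).obj ⊤}
    (h : (gen A E).res b x = (gen A E).res b y) {c : A} (hc : c ≤ b) {e : E}
    (hx : c ≤ coeff x e) : c ≤ coeff y e := by
  have := congrFun (congrArg Subtype.val h) e
  change b ⊓ coeff x e = b ⊓ coeff y e at this
  exact ((le_inf hc hx).trans this.le).trans inf_le_right

theorem rel_res_iff {r : E → F → Prop} {b : A} {x : (gen A E).obj ⊤} {y : (gen A F).obj ⊤} :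
    Rel r ((gen A E).res b x) ((gen A F).res b y) ↔
      ∀ c ≤ b, c ≠ ⊥ → ∀ e e', c ≤ coeff x e → c ≤ coeff y e' → r e e' := by
  constructor
  · intro h c hcb hc e e' h1 h2
    refine h e e' (fun h0 => hc (le_bot_iff.1 (le_trans ?_ h0.le)))
    exact le_inf (le_inf hcb h1) (le_inf hcb h2)
  · intro h e e' hne
    refine h _ ?_ hne e e' ?_ ?_
    · exact inf_le_left.trans inf_le_left
    · exact inf_le_left.trans inf_le_right
    · exact inf_le_right.trans inf_le_right

theorem rel_iff {r : E → F → Prop} {x : (gen A E).obj ⊤} {y : (gen A F).obj ⊤} :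
    Rel r x y ↔ ∀ c, c ≠ ⊥ → ∀ e e', c ≤ coeff x e → c ≤ coeff y e' → r e e' := by
  have := rel_res_iff (r := r) (b := ⊤) (x := x) (y := y)
  rw [(gen A E).res_top, (gen A F).res_top] at this
  simpa using this

theorem ext₃ {x y z : (gen A E).obj ⊤} {s t : (gen A F).obj ⊤}
    (h : ∀ c e₁ e₂ e₃, c ≤ coeff x e₁ → c ≤ coeff y e₂ → c ≤ coeff z e₃ →
      ∃ g, c ≤ coeff s g ∧ c ≤ coeff t g) : s = t := by
  refine Subtype.ext (partition_ext s.2 t.2 fun b hb g g' hg hg' => ?_)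
  obtain ⟨c₁, h₁, hc₁, e₁, he₁⟩ := exists_dec x hb
  obtain ⟨c₂, h₂, hc₂, e₂, he₂⟩ := exists_dec y hc₁
  obtain ⟨c₃, h₃, hc₃, e₃, he₃⟩ := exists_dec z hc₂
  obtain ⟨g₀, h4, h5⟩ := h c₃ e₁ e₂ e₃ ((h₃.trans h₂).trans he₁) (h₃.trans he₂) he₃
  have hle : c₃ ≤ b := (h₃.trans h₂).trans h₁
  rw [eq_of_le hc₃ (x := s) (hle.trans hg) h4, eq_of_le hc₃ (x := t) (hle.trans hg') h5]

instance : Add ((gen A ℚ).obj ⊤) := ⟨map₂ (· + ·)⟩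
instance : Mul ((gen A ℚ).obj ⊤) := ⟨map₂ (· * ·)⟩
instance : Neg ((gen A ℚ).obj ⊤) := ⟨map (- ·)⟩
instance : Zero ((gen A ℚ).obj ⊤) := ⟨pure A 0⟩
instance : One ((gen A ℚ).obj ⊤) := ⟨pure A 1⟩

/-- The ring structure on the primal set of the conditional rationals, generated by the
operations of `ℚ`. -/
instance : CommRing ((gen A ℚ).obj ⊤) where
  add_assoc x y z := ext₃ (x := x) (y := y) (z := z) fun c e₁ e₂ e₃ h₁ h₂ h₃ =>
    ⟨e₁ + e₂ + e₃, le_coeff_map₂ (· + ·) (le_coeff_map₂ (· + ·) h₁ h₂) h₃, by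
      rw [add_assoc]; exact le_coeff_map₂ (· + ·) h₁ (le_coeff_map₂ (· + ·) h₂ h₃)⟩
  zero_add x := ext₃ (x := x) (y := x) (z := x) fun c e₁ _ _ h₁ _ _ =>
    ⟨0 + e₁, le_coeff_map₂ (· + ·) (le_coeff_pure c 0) h₁, by rwa [zero_add]⟩
  add_zero x := ext₃ (x := x) (y := x) (z := x) fun c e₁ _ _ h₁ _ _ =>
    ⟨e₁ + 0, le_coeff_map₂ (· + ·) h₁ (le_coeff_pure c 0), by rwa [add_zero]⟩
  add_comm x y := ext₃ (x := x) (y := y) (z := x) fun c e₁ e₂ _ h₁ h₂ _ =>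
    ⟨e₁ + e₂, le_coeff_map₂ (· + ·) h₁ h₂, by
      rw [add_comm]; exact le_coeff_map₂ (· + ·) h₂ h₁⟩
  neg_add_cancel x := ext₃ (x := x) (y := x) (z := x) fun c e₁ _ _ h₁ _ _ =>
    ⟨-e₁ + e₁, le_coeff_map₂ (· + ·) (le_coeff_map (- ·) h₁) h₁, by
      rw [neg_add_cancel]; exact le_coeff_pure c 0⟩
  mul_assoc x y z := ext₃ (x := x) (y := y) (z := z) fun c e₁ e₂ e₃ h₁ h₂ h₃ =>
    ⟨e₁ * e₂ * e₃, le_coeff_map₂ (· * ·) (le_coeff_map₂ (· * ·) h₁ h₂) h₃, by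
      rw [mul_assoc]; exact le_coeff_map₂ (· * ·) h₁ (le_coeff_map₂ (· * ·) h₂ h₃)⟩
  one_mul x := ext₃ (x := x) (y := x) (z := x) fun c e₁ _ _ h₁ _ _ =>
    ⟨1 * e₁, le_coeff_map₂ (· * ·) (le_coeff_pure c 1) h₁, by rwa [one_mul]⟩
  mul_one x := ext₃ (x := x) (y := x) (z := x) fun c e₁ _ _ h₁ _ _ =>
    ⟨e₁ * 1, le_coeff_map₂ (· * ·) h₁ (le_coeff_pure c 1), by rwa [mul_one]⟩
  zero_mul x := ext₃ (x := x) (y := x) (z := x) fun c e₁ _ _ h₁ _ _ =>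
    ⟨0 * e₁, le_coeff_map₂ (· * ·) (le_coeff_pure c 0) h₁, by
      rw [zero_mul]; exact le_coeff_pure c 0⟩
  mul_zero x := ext₃ (x := x) (y := x) (z := x) fun c e₁ _ _ h₁ _ _ =>
    ⟨e₁ * 0, le_coeff_map₂ (· * ·) h₁ (le_coeff_pure c 0), by
      rw [mul_zero]; exact le_coeff_pure c 0⟩
  mul_comm x y := ext₃ (x := x) (y := y) (z := x) fun c e₁ e₂ _ h₁ h₂ _ =>
    ⟨e₁ * e₂, le_coeff_map₂ (· * ·) h₁ h₂, by
      rw [mul_comm]; exact le_coeff_map₂ (· * ·) h₂ h₁⟩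
  left_distrib x y z := ext₃ (x := x) (y := y) (z := z) fun c e₁ e₂ e₃ h₁ h₂ h₃ =>
    ⟨e₁ * (e₂ + e₃), le_coeff_map₂ (· * ·) h₁ (le_coeff_map₂ (· + ·) h₂ h₃), by
      rw [mul_add]
      exact le_coeff_map₂ (· + ·) (le_coeff_map₂ (· * ·) h₁ h₂) (le_coeff_map₂ (· * ·) h₁ h₃)⟩
  right_distrib x y z := ext₃ (x := x) (y := y) (z := z) fun c e₁ e₂ e₃ h₁ h₂ h₃ =>
    ⟨(e₁ + e₂) * e₃, le_coeff_map₂ (· * ·) (le_coeff_map₂ (· + ·) h₁ h₂) h₃, by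
      rw [add_mul]
      exact le_coeff_map₂ (· + ·) (le_coeff_map₂ (· * ·) h₁ h₃) (le_coeff_map₂ (· * ·) h₂ h₃)⟩
  nsmul := nsmulRec
  zsmul := zsmulRec

end Gen

/-! The conditional real numbers, as classes of conditional Cauchy sequences of conditional
rationals. -/

namespace CondReal

open Gen

universe u

variable {A : Type u} [CompleteBooleanAlgebra A]

/-- The conditional absolute value on the conditional rationals. -/
def qabs (x : (gen A ℚ).obj ⊤) : (gen A ℚ).obj ⊤ := map (fun q : ℚ => |q|) x

/-- `s` is the primal part of a conditional sequence, that is, of a conditional function from the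
conditional natural numbers to the conditional rational numbers. -/
def IsCondSeq (s : (gen A ℕ).obj ⊤ → (gen A ℚ).obj ⊤) : Prop :=
  ∃ q : CondFun (gen A ℕ) (gen A ℚ), ∀ n, q n = s n

/-- Conditional Cauchy sequences. -/
def IsCauchy (s : (gen A ℕ).obj ⊤ → (gen A ℚ).obj ⊤) : Prop :=
  ∀ ε : (gen A ℚ).obj ⊤, Rel (· < ·) 0 ε → ∃ n₀ : (gen A ℕ).obj ⊤, ∀ m n,
    Rel (· ≤ ·) n₀ m → Rel (· ≤ ·) n₀ n → Rel (· < ·) (qabs (s m - s n)) ε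

/-- The conditional sequence `s` converges conditionally to zero on the condition `a`. -/
def IsNull (a : A) (s : (gen A ℕ).obj ⊤ → (gen A ℚ).obj ⊤) : Prop :=
  ∀ ε : (gen A ℚ).obj ⊤, Rel (· < ·) 0 ε → ∃ n₀ : (gen A ℕ).obj ⊤, ∀ n,
    Rel (· ≤ ·) n₀ n → Rel (· < ·) ((gen A ℚ).res a (qabs (s n))) ((gen A ℚ).res a ε)

theorem isCondSeq_iff {s : (gen A ℕ).obj ⊤ → (gen A ℚ).obj ⊤} : IsCondSeq s ↔
    ∀ a x y, (gen A ℕ).res a x = (gen A ℕ).res a y →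
      (gen A ℚ).res a (s x) = (gen A ℚ).res a (s y) := by
  constructor
  · rintro ⟨q, hq⟩ a x y h
    rw [← hq, ← hq]
    exact q.congr_res a h
  · intro h
    exact ⟨CondFun.ofPrimal s h, CondFun.ofPrimal_apply s h⟩

theorem le_coeff_sub {x y : (gen A ℚ).obj ⊤} {c : A} {e e' : ℚ} (h : c ≤ coeff x e)
    (h' : c ≤ coeff y e') : c ≤ coeff (x - y) (e - e') := by
  rw [sub_eq_add_neg, sub_eq_add_neg]
  exact le_coeff_map₂ (· + ·) h (le_coeff_map (- ·) h')

theorem le_coeff_zero (c : A) : c ≤ coeff (0 : (gen A ℚ).obj ⊤) 0 := le_coeff_pure c 0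

theorem pos_iff {ε : (gen A ℚ).obj ⊤} :
    Rel (· < ·) 0 ε ↔ ∀ c, c ≠ ⊥ → ∀ e, c ≤ coeff ε e → (0 : ℚ) < e := by
  rw [rel_iff]
  constructor
  · intro h c hc e he
    exact h c hc 0 e (le_coeff_zero c) he
  · intro h c hc e e' h1 h2
    rw [eq_of_le hc h1 (le_coeff_zero c)]
    exact h c hc e' h2

theorem qabs_lt_iff {a : A} {x ε : (gen A ℚ).obj ⊤} :
    Rel (· < ·) ((gen A ℚ).res a (qabs x)) ((gen A ℚ).res a ε) ↔
      ∀ c ≤ a, c ≠ ⊥ → ∀ e e', c ≤ coeff x e → c ≤ coeff ε e' → |e| < e' := by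
  rw [rel_res_iff]
  constructor
  · intro h c hca hc e e' h1 h2
    exact h c hca hc _ e' (le_coeff_map (fun q : ℚ => |q|) h1) h2
  · intro h c hca hc g e' h1 h2
    obtain ⟨d, hdc, hd, e, he⟩ := exists_dec x hc
    rw [eq_of_le hd (hdc.trans h1) (le_coeff_map (fun q : ℚ => |q|) he)]
    exact h d (hdc.trans hca) hd e e' he (hdc.trans h2)

theorem qabs_lt_iff' {x ε : (gen A ℚ).obj ⊤} :
    Rel (· < ·) (qabs x) ε ↔
      ∀ c, c ≠ ⊥ → ∀ e e', c ≤ coeff x e → c ≤ coeff ε e' → |e| < e' := by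
  have := qabs_lt_iff (a := ⊤) (x := x) (ε := ε)
  rw [(gen A ℚ).res_top, (gen A ℚ).res_top] at this
  simpa using this

theorem qabs_sub_lt_iff {x y ε : (gen A ℚ).obj ⊤} :
    Rel (· < ·) (qabs (x - y)) ε ↔ ∀ c, c ≠ ⊥ → ∀ e₁ e₂ e', c ≤ coeff x e₁ → c ≤ coeff y e₂ →
      c ≤ coeff ε e' → |e₁ - e₂| < e' := by
  rw [qabs_lt_iff']
  constructor
  · intro h c hc e₁ e₂ e' h1 h2 h3
    exact h c hc _ e' (le_coeff_sub h1 h2) h3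
  · intro h c hc g e' h1 h2
    obtain ⟨d, hdc, hd, e, he⟩ := exists_dec x hc
    obtain ⟨d', hdc', hd', e₂, he₂⟩ := exists_dec y hd
    rw [eq_of_le hd' ((hdc'.trans hdc).trans h1) (le_coeff_sub (hdc'.trans he) he₂)]
    exact h d' hd' _ _ _ (hdc'.trans he) he₂ ((hdc'.trans hdc).trans h2)

/-- Two conditional natural numbers have a common upper bound. -/
theorem exists_ub (n₁ n₂ : (gen A ℕ).obj ⊤) : ∃ n₀ : (gen A ℕ).obj ⊤, ∀ n,
    Rel (· ≤ ·) n₀ n → Rel (· ≤ ·) n₁ n ∧ Rel (· ≤ ·) n₂ n := by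
  refine ⟨map₂ max n₁ n₂, fun n h => ⟨?_, ?_⟩⟩
  · rw [rel_iff] at h ⊢
    intro c hc e e' h1 h2
    obtain ⟨d, hdc, hd, e₂, he₂⟩ := exists_dec n₂ hc
    exact (le_max_left _ _).trans (h d hd _ e' (le_coeff_map₂ max (hdc.trans h1) he₂)
      (hdc.trans h2))
  · rw [rel_iff] at h ⊢
    intro c hc e e' h1 h2
    obtain ⟨d, hdc, hd, e₂, he₂⟩ := exists_dec n₁ hc
    exact (le_max_right _ _).trans (h d hd _ e' (le_coeff_map₂ max he₂ (hdc.trans h1))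
      (hdc.trans h2))

theorem pos_map (f : ℚ → ℚ) (hf : ∀ q, 0 < q → 0 < f q) {ε : (gen A ℚ).obj ⊤}
    (h : Rel (· < ·) 0 ε) : Rel (· < ·) (0 : (gen A ℚ).obj ⊤) (map f ε) := by
  rw [pos_iff] at h ⊢
  intro c hc g hg
  obtain ⟨d, hdc, hd, e, he⟩ := exists_dec ε hc
  rw [eq_of_le hd (hdc.trans hg) (le_coeff_map f he)]
  exact hf _ (h d hd e he)

theorem pos_map₂ (f : ℚ → ℚ → ℚ) (hf : ∀ q r, 0 < q → 0 < r → 0 < f q r)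
    {ε δ : (gen A ℚ).obj ⊤} (h : Rel (· < ·) 0 ε) (h' : Rel (· < ·) 0 δ) :
    Rel (· < ·) (0 : (gen A ℚ).obj ⊤) (map₂ f ε δ) := by
  rw [pos_iff] at h h' ⊢
  intro c hc g hg
  obtain ⟨d, hdc, hd, e, he⟩ := exists_dec ε hc
  obtain ⟨d', hdc', hd', e₂, he₂⟩ := exists_dec δ hd
  rw [eq_of_le hd' ((hdc'.trans hdc).trans hg) (le_coeff_map₂ f (hdc'.trans he) he₂)]
  exact hf _ _ (h d hd e he) (h' d' hd' e₂ he₂)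

theorem rel_refl {n : (gen A ℕ).obj ⊤} : Rel (· ≤ ·) n n := by
  rw [rel_iff]
  intro c hc e e' h1 h2
  exact (eq_of_le hc h1 h2).le

theorem IsCauchy.bounded {s : (gen A ℕ).obj ⊤ → (gen A ℚ).obj ⊤} (hs : IsCauchy s) :
    ∃ M : (gen A ℚ).obj ⊤, Rel (· < ·) 0 M ∧ ∃ n₀, ∀ n, Rel (· ≤ ·) n₀ n →
      ∀ c, c ≠ ⊥ → ∀ e e', c ≤ coeff (s n) e → c ≤ coeff M e' → |e| < e' := by
  have h1 : Rel (· < ·) (0 : (gen A ℚ).obj ⊤) (pure A (1 : ℚ)) := by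
    rw [pos_iff]
    intro c hc e he
    rw [eq_of_le hc he (le_coeff_pure c 1)]
    exact one_pos
  obtain ⟨n₀, hn₀⟩ := hs _ h1
  refine ⟨map (fun q : ℚ => |q| + 1) (s n₀), ?_, n₀, ?_⟩
  · rw [pos_iff]
    intro c hc g hg
    obtain ⟨d, hdc, hd, e, he⟩ := exists_dec (s n₀) hc
    rw [eq_of_le hd (hdc.trans hg) (le_coeff_map (fun q : ℚ => |q| + 1) he)]
    positivity
  · intro n hn c hc e g he hg
    obtain ⟨d, hdc, hd, e₀, he₀⟩ := exists_dec (s n₀) hc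
    rw [eq_of_le hd (hdc.trans hg) (le_coeff_map (fun q : ℚ => |q| + 1) he₀)]
    have := (qabs_sub_lt_iff.1 (hn₀ n n₀ hn rel_refl)) d hd e e₀ 1 (hdc.trans he) he₀
      (le_coeff_pure d 1)
    have h3 := abs_sub_abs_le_abs_sub e e₀
    linarith

theorem IsCauchy.mul {s t : (gen A ℕ).obj ⊤ → (gen A ℚ).obj ⊤} (hs : IsCauchy s)
    (ht : IsCauchy t) : IsCauchy (s * t) := by
  intro ε hε
  obtain ⟨M, hM, n₁, h₁⟩ := hs.bounded
  obtain ⟨M', hM', n₂, h₂⟩ := ht.bounded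
  have hpos : ∀ q r : ℚ, 0 < q → 0 < r → 0 < q / (2 * r) := fun q r h h' => by positivity
  obtain ⟨n₃, h₃⟩ := hs _ (pos_map₂ (fun q r => q / (2 * r)) hpos hε hM')
  obtain ⟨n₄, h₄⟩ := ht _ (pos_map₂ (fun q r => q / (2 * r)) hpos hε hM)
  obtain ⟨k₁, hk₁⟩ := exists_ub n₁ n₂
  obtain ⟨k₂, hk₂⟩ := exists_ub n₃ n₄
  obtain ⟨k, hk⟩ := exists_ub k₁ k₂
  refine ⟨k, fun m n hm hn => ?_⟩
  have hm₁ := hk₁ _ (hk _ hm).1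
  have hm₂ := hk₂ _ (hk _ hm).2
  have hn₁ := hk₁ _ (hk _ hn).1
  have hn₂ := hk₂ _ (hk _ hn).2
  rw [qabs_sub_lt_iff]
  intro c hc g₁ g₂ e hg₁ hg₂ he
  obtain ⟨d₁, hd₁, hb₁, a, ha⟩ := exists_dec (s m) hc
  obtain ⟨d₂, hd₂, hb₂, b, hb⟩ := exists_dec (s n) hb₁
  obtain ⟨d₃, hd₃, hb₃, a', ha'⟩ := exists_dec (t m) hb₂
  obtain ⟨d₄, hd₄, hb₄, b', hb'⟩ := exists_dec (t n) hb₃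
  obtain ⟨d₅, hd₅, hb₅, r, hr⟩ := exists_dec M hb₄
  obtain ⟨d, hd, hb₆, r', hr'⟩ := exists_dec M' hb₅
  have l₄ : d ≤ d₄ := hd.trans hd₅
  have l₃ : d ≤ d₃ := l₄.trans hd₄
  have l₂ : d ≤ d₂ := l₃.trans hd₃
  have l₁ : d ≤ d₁ := l₂.trans hd₂
  have l₀ : d ≤ c := l₁.trans hd₁
  have ha := l₁.trans ha
  have hb := l₂.trans hb
  have ha' := l₃.trans ha'
  have hb' := l₄.trans hb'
  have hr := hd.trans hr
  have he := l₀.trans he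
  rw [eq_of_le hb₆ (l₀.trans hg₁) (le_coeff_map₂ (· * ·) ha ha'),
    eq_of_le hb₆ (l₀.trans hg₂) (le_coeff_map₂ (· * ·) hb hb')]
  have i₁ := qabs_sub_lt_iff.1 (h₃ m n hm₂.1 hn₂.1) d hb₆ a b _ ha hb
    (le_coeff_map₂ (fun q r => q / (2 * r)) he hr')
  have i₂ := qabs_sub_lt_iff.1 (h₄ m n hm₂.2 hn₂.2) d hb₆ a' b' _ ha' hb'
    (le_coeff_map₂ (fun q r => q / (2 * r)) he hr)
  have i₃ := h₁ n hn₁.1 d hb₆ b r hb hr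
  have i₄ := h₂ m hm₁.2 d hb₆ a' r' ha' hr'
  have p : 0 < r := pos_iff.1 hM d hb₆ r hr
  have p' : 0 < r' := pos_iff.1 hM' d hb₆ r' hr'
  have key : a * a' - b * b' = (a - b) * a' + b * (a' - b') := by ring
  change |a * a' - b * b'| < e
  rw [key]
  have j₁ : |(a - b) * a'| ≤ |a - b| * r' := by
    rw [abs_mul]; exact mul_le_mul_of_nonneg_left i₄.le (abs_nonneg _)
  have j₂ : |b * (a' - b')| ≤ r * |a' - b'| := by
    rw [abs_mul]; exact mul_le_mul_of_nonneg_right i₃.le (abs_nonneg _)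
  have j₃ : |a - b| * r' < e / 2 := by
    calc |a - b| * r' < e / (2 * r') * r' := mul_lt_mul_of_pos_right i₁ p'
      _ = e / 2 := by field_simp
  have j₄ : r * |a' - b'| < e / 2 := by
    calc r * |a' - b'| < r * (e / (2 * r)) := mul_lt_mul_of_pos_left i₂ p
      _ = e / 2 := by field_simp
  have := abs_add_le ((a - b) * a') (b * (a' - b'))
  linarith

theorem IsCauchy.add {s t : (gen A ℕ).obj ⊤ → (gen A ℚ).obj ⊤} (hs : IsCauchy s)
    (ht : IsCauchy t) : IsCauchy (s + t) := by
  intro ε hε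
  have hpos : ∀ q : ℚ, 0 < q → 0 < q / 2 := fun q h => by positivity
  obtain ⟨n₃, h₃⟩ := hs _ (pos_map (fun q => q / 2) hpos hε)
  obtain ⟨n₄, h₄⟩ := ht _ (pos_map (fun q => q / 2) hpos hε)
  obtain ⟨k, hk⟩ := exists_ub n₃ n₄
  refine ⟨k, fun m n hm hn => ?_⟩
  rw [qabs_sub_lt_iff]
  intro c hc g₁ g₂ e hg₁ hg₂ he
  obtain ⟨d₁, hd₁, hb₁, a, ha⟩ := exists_dec (s m) hc
  obtain ⟨d₂, hd₂, hb₂, b, hb⟩ := exists_dec (s n) hb₁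
  obtain ⟨d₃, hd₃, hb₃, a', ha'⟩ := exists_dec (t m) hb₂
  obtain ⟨d, hd₄, hb₄, b', hb'⟩ := exists_dec (t n) hb₃
  have l₂ : d ≤ d₂ := hd₄.trans hd₃
  have l₁ : d ≤ d₁ := l₂.trans hd₂
  have l₀ : d ≤ c := l₁.trans hd₁
  have ha := l₁.trans ha
  have hb := l₂.trans hb
  have ha' := hd₄.trans ha'
  have he := l₀.trans he
  rw [eq_of_le hb₄ (l₀.trans hg₁) (le_coeff_map₂ (· + ·) ha ha'),
    eq_of_le hb₄ (l₀.trans hg₂) (le_coeff_map₂ (· + ·) hb hb')]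
  have i₁ := qabs_sub_lt_iff.1 (h₃ m n (hk _ hm).1 (hk _ hn).1) d hb₄ a b _ ha hb
    (le_coeff_map (fun q => q / 2) he)
  have i₂ := qabs_sub_lt_iff.1 (h₄ m n (hk _ hm).2 (hk _ hn).2) d hb₄ a' b' _ ha' hb'
    (le_coeff_map (fun q => q / 2) he)
  have key : a + a' - (b + b') = (a - b) + (a' - b') := by ring
  change |a + a' - (b + b')| < e
  rw [key]
  have := abs_add_le (a - b) (a' - b')
  linarith

theorem IsCauchy.neg {s : (gen A ℕ).obj ⊤ → (gen A ℚ).obj ⊤} (hs : IsCauchy s) :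
    IsCauchy (-s) := by
  intro ε hε
  obtain ⟨k, h⟩ := hs _ hε
  refine ⟨k, fun m n hm hn => ?_⟩
  rw [qabs_sub_lt_iff]
  intro c hc g₁ g₂ e hg₁ hg₂ he
  obtain ⟨d₁, hd₁, hb₁, a, ha⟩ := exists_dec (s m) hc
  obtain ⟨d, hd, hb₂, b, hb⟩ := exists_dec (s n) hb₁
  have l₀ : d ≤ c := hd.trans hd₁
  rw [eq_of_le hb₂ (l₀.trans hg₁) (le_coeff_map (- ·) (hd.trans ha)),
    eq_of_le hb₂ (l₀.trans hg₂) (le_coeff_map (- ·) hb)]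
  have i₁ := qabs_sub_lt_iff.1 (h m n hm hn) d hb₂ a b _ (hd.trans ha) hb (l₀.trans he)
  change |-a - -b| < e
  rw [neg_sub_neg, abs_sub_comm]
  exact i₁

theorem isCauchy_const (x : (gen A ℚ).obj ⊤) : IsCauchy (fun _ => x) := by
  intro ε hε
  refine ⟨pure A 0, fun m n _ _ => ?_⟩
  rw [qabs_sub_lt_iff]
  intro c hc g₁ g₂ e hg₁ hg₂ he
  rw [eq_of_le hc hg₁ hg₂, sub_self, abs_zero]
  exact pos_iff.1 hε c hc e he

theorem res_map {E F : Type*} [Nonempty E] [Nonempty F] (f : E → F) {a : A}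
    {x x' : (gen A E).obj ⊤} (hx : (gen A E).res a x = (gen A E).res a x') :
    (gen A F).res a (map f x) = (gen A F).res a (map f x') := by
  rw [res_eq_iff]
  intro c hca hc g g' hg hg'
  obtain ⟨d, hdc, hd, e, he⟩ := exists_dec x hc
  rw [eq_of_le hd (hdc.trans hg) (le_coeff_map f he), eq_of_le hd (hdc.trans hg')
    (le_coeff_map f (le_coeff_congr hx (hdc.trans hca) he))]

theorem res_map₂ {E F G : Type*} [Nonempty E] [Nonempty F] [Nonempty G] (f : E → F → G) {a : A}
    {x x' : (gen A E).obj ⊤} {y y' : (gen A F).obj ⊤}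
    (hx : (gen A E).res a x = (gen A E).res a x')
    (hy : (gen A F).res a y = (gen A F).res a y') :
    (gen A G).res a (map₂ f x y) = (gen A G).res a (map₂ f x' y') := by
  rw [res_eq_iff]
  intro c hca hc g g' hg hg'
  obtain ⟨d₁, hdc₁, hd₁, e, he⟩ := exists_dec x hc
  obtain ⟨d, hdc, hd, e', he'⟩ := exists_dec y hd₁
  have hle := hdc.trans hdc₁
  have he := hdc.trans he
  rw [eq_of_le hd (hle.trans hg) (le_coeff_map₂ f he he'), eq_of_le hd (hle.trans hg')
    (le_coeff_map₂ f (le_coeff_congr hx (hle.trans hca) he)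
      (le_coeff_congr hy (hle.trans hca) he'))]

variable (A) in
/-- The conditional Cauchy sequences of conditional rationals, as a ring with the pointwise
operations. A conditional sequence is represented by its primal part. -/
def cauchySeq : Subring ((gen A ℕ).obj ⊤ → (gen A ℚ).obj ⊤) where
  carrier := {s | IsCondSeq s ∧ IsCauchy s}
  mul_mem' hs ht := ⟨isCondSeq_iff.2 fun a x y h => res_map₂ (· * ·)
    (isCondSeq_iff.1 hs.1 a x y h) (isCondSeq_iff.1 ht.1 a x y h), hs.2.mul ht.2⟩
  one_mem' := ⟨isCondSeq_iff.2 fun _ _ _ _ => rfl, isCauchy_const 1⟩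
  add_mem' hs ht := ⟨isCondSeq_iff.2 fun a x y h => res_map₂ (· + ·)
    (isCondSeq_iff.1 hs.1 a x y h) (isCondSeq_iff.1 ht.1 a x y h), hs.2.add ht.2⟩
  zero_mem' := ⟨isCondSeq_iff.2 fun _ _ _ _ => rfl, isCauchy_const 0⟩
  neg_mem' hs := ⟨isCondSeq_iff.2 fun a x y h => res_map (- ·)
    (isCondSeq_iff.1 hs.1 a x y h), hs.2.neg⟩

/-- The ideal of the conditional Cauchy sequences that converge conditionally to zero on `a`;
two conditional Cauchy sequences are equivalent on `a` if their difference belongs to it. -/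
def nullIdeal (a : A) : Ideal (cauchySeq A) where
  carrier := {s | IsNull a s.1}
  add_mem' {s t} hs ht := by
    intro ε hε
    have hpos : ∀ q : ℚ, 0 < q → 0 < q / 2 := fun q h => by positivity
    obtain ⟨n₃, h₃⟩ := hs _ (pos_map (fun q => q / 2) hpos hε)
    obtain ⟨n₄, h₄⟩ := ht _ (pos_map (fun q => q / 2) hpos hε)
    obtain ⟨k, hk⟩ := exists_ub n₃ n₄
    refine ⟨k, fun n hn => ?_⟩
    rw [qabs_lt_iff]
    intro c hca hc g e hg he
    obtain ⟨d₁, hd₁, hb₁, x, hx⟩ := exists_dec (s.1 n) hc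
    obtain ⟨d, hd, hb, y, hy⟩ := exists_dec (t.1 n) hb₁
    have l₀ : d ≤ c := hd.trans hd₁
    rw [eq_of_le hb (l₀.trans hg) (le_coeff_map₂ (· + ·) (hd.trans hx) hy)]
    have i₁ := qabs_lt_iff.1 (h₃ n (hk _ hn).1) d (l₀.trans hca) hb x _ (hd.trans hx)
      (le_coeff_map (fun q => q / 2) (l₀.trans he))
    have i₂ := qabs_lt_iff.1 (h₄ n (hk _ hn).2) d (l₀.trans hca) hb y _ hy
      (le_coeff_map (fun q => q / 2) (l₀.trans he))
    have := abs_add_le x y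
    change |x + y| < e
    linarith
  zero_mem' := by
    intro ε hε
    refine ⟨pure A 0, fun n _ => ?_⟩
    rw [qabs_lt_iff]
    intro c _ hc g e hg he
    rw [eq_of_le hc hg (le_coeff_zero c), abs_zero]
    exact pos_iff.1 hε c hc e he
  smul_mem' s t ht := by
    intro ε hε
    obtain ⟨M, hM, n₁, h₁⟩ := s.2.2.bounded
    have hpos : ∀ q r : ℚ, 0 < q → 0 < r → 0 < q / r := fun q r h h' => by positivity
    obtain ⟨n₂, h₂⟩ := ht _ (pos_map₂ (fun q r => q / r) hpos hε hM)
    obtain ⟨k, hk⟩ := exists_ub n₁ n₂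
    refine ⟨k, fun n hn => ?_⟩
    rw [qabs_lt_iff]
    intro c hca hc g e hg he
    obtain ⟨d₁, hd₁, hb₁, x, hx⟩ := exists_dec (s.1 n) hc
    obtain ⟨d₂, hd₂, hb₂, y, hy⟩ := exists_dec (t.1 n) hb₁
    obtain ⟨d, hd₃, hb, r, hr⟩ := exists_dec M hb₂
    have l₁ : d ≤ d₁ := hd₃.trans hd₂
    have l₀ : d ≤ c := l₁.trans hd₁
    have hx := l₁.trans hx
    have hy := hd₃.trans hy
    rw [eq_of_le hb (l₀.trans hg) (le_coeff_map₂ (· * ·) hx hy)]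
    have i₁ := h₁ n (hk _ hn).1 d hb x r hx hr
    have i₂ := qabs_lt_iff.1 (h₂ n (hk _ hn).2) d (l₀.trans hca) hb y _ hy
      (le_coeff_map₂ (fun q r => q / r) (l₀.trans he) hr)
    have p : 0 < r := pos_iff.1 hM d hb r hr
    change |x * y| < e
    rw [abs_mul]
    calc |x| * |y| ≤ r * |y| := mul_le_mul_of_nonneg_right i₁.le (abs_nonneg _)
      _ < r * (e / r) := mul_lt_mul_of_pos_left i₂ p
      _ = e := by field_simp

theorem nullIdeal_anti {a b : A} (h : a ≤ b) : nullIdeal b ≤ nullIdeal a := by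
  intro s hs ε hε
  obtain ⟨n₀, hn₀⟩ := hs ε hε
  refine ⟨n₀, fun n hn => ?_⟩
  have := qabs_lt_iff.1 (hn₀ n hn)
  rw [qabs_lt_iff]
  exact fun c hc => this c (hc.trans h)

/-- If `n₀ ≤ n` holds on `b`, then `n` agrees on `b` with some `n'` with `n₀ ≤ n'`. -/
theorem exists_extend {b : A} {n₀ n : (gen A ℕ).obj ⊤}
    (h : Rel (· ≤ ·) ((gen A ℕ).res b n₀) ((gen A ℕ).res b n)) :
    ∃ n', (gen A ℕ).res b n' = (gen A ℕ).res b n ∧ Rel (· ≤ ·) n₀ n' := by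
  let cc : ULift.{u} Bool → A := fun i => if i.down then b else bᶜ
  have hcc : IsPartition ⊤ cc := by
    refine ⟨?_, ?_⟩
    · rintro ⟨i⟩ ⟨j⟩ hij
      cases i <;> cases j <;> simp_all [cc, disjoint_compl_right, disjoint_compl_left]
    · rw [eq_top_iff, ← sup_compl_eq_top (x := b)]
      exact sup_le (le_iSup cc ⟨true⟩) (le_iSup cc ⟨false⟩)
  obtain ⟨n', hn', -⟩ := (gen A ℕ).stability cc hcc fun i =>
    (gen A ℕ).res (cc i) (if i.down then n else n₀)
  have h1 : (gen A ℕ).res b n' = (gen A ℕ).res b n := hn' ⟨true⟩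
  have h2 : (gen A ℕ).res bᶜ n' = (gen A ℕ).res bᶜ n₀ := hn' ⟨false⟩
  refine ⟨n', h1, ?_⟩
  rw [rel_iff]
  intro c hc e e' he he'
  by_cases hcb : c ⊓ b = ⊥
  · have hle : c ≤ bᶜ := le_compl_iff_disjoint_right.2 (disjoint_iff.2 hcb)
    exact (eq_of_le hc he (le_coeff_congr h2 hle he')).le
  · exact rel_res_iff.1 h (c ⊓ b) inf_le_right hcb e e' (inf_le_left.trans he)
      (le_coeff_congr h1 inf_le_right (inf_le_left.trans he'))

theorem rel_res_of_rel {E F : Type*} [Nonempty E] [Nonempty F] {r : E → F → Prop}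
    {x : (gen A E).obj ⊤} {y : (gen A F).obj ⊤} (h : Rel r x y) (b : A) :
    Rel r ((gen A E).res b x) ((gen A F).res b y) :=
  rel_res_iff.2 fun c _ => rel_iff.1 h c

theorem isNull_of_partition {ι : Type u} {c : ι → A} (hc : IsPartition ⊤ c)
    {s : (gen A ℕ).obj ⊤ → (gen A ℚ).obj ⊤} (hs : IsCondSeq s) (h : ∀ i, IsNull (c i) s) :
    IsNull ⊤ s := by
  intro ε hε
  choose n₀ hn₀ using fun i => h i ε hε
  obtain ⟨k, hk, -⟩ := (gen A ℕ).stability c hc fun i => (gen A ℕ).res (c i) (n₀ i)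
  refine ⟨k, fun n hn => ?_⟩
  rw [qabs_lt_iff]
  intro b _ hb e e' he he'
  obtain ⟨i, hi⟩ := exists_inf_ne_bot hc le_top hb
  have hr := rel_res_of_rel hn (c i)
  rw [hk i] at hr
  obtain ⟨n', hn', hle⟩ := exists_extend hr
  have hsn := isCondSeq_iff.1 hs (c i) n n' hn'.symm
  exact qabs_lt_iff.1 (hn₀ i n' hle) (b ⊓ c i) inf_le_right hi e e'
    (le_coeff_congr hsn inf_le_right (inf_le_left.trans he)) (inf_le_left.trans he')

theorem exists_amalgam {ι : Type u} {c : ι → A} (hc : IsPartition ⊤ c)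
    (p : ι → cauchySeq A) : ∃ q : cauchySeq A, ∀ i, q - p i ∈ nullIdeal (c i) := by
  choose q hq _ using fun n : (gen A ℕ).obj ⊤ =>
    (gen A ℚ).stability c hc fun i => (gen A ℚ).res (c i) ((p i).1 n)
  have hqs : IsCondSeq q := by
    rw [isCondSeq_iff]
    intro a n m h
    rw [res_eq_iff]
    intro b hba hb e e' he he'
    obtain ⟨i, hi⟩ := exists_inf_ne_bot hc le_top hb
    have hp := isCondSeq_iff.1 (p i).2.1 a n m h
    refine eq_of_le hi (x := (p i).1 m) ?_ ?_
    · exact le_coeff_congr hp (inf_le_left.trans hba)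
        (le_coeff_congr (hq n i) inf_le_right (inf_le_left.trans he))
    · exact le_coeff_congr (hq m i) inf_le_right (inf_le_left.trans he')
  have hqc : IsCauchy q := by
    intro ε hε
    choose n₀ hn₀ using fun i => (p i).2.2 ε hε
    obtain ⟨k, hk, -⟩ := (gen A ℕ).stability c hc fun i => (gen A ℕ).res (c i) (n₀ i)
    refine ⟨k, fun m n hm hn => ?_⟩
    rw [qabs_sub_lt_iff]
    intro b hb e₁ e₂ e' he₁ he₂ he'
    obtain ⟨i, hi⟩ := exists_inf_ne_bot hc le_top hb
    have hrm := rel_res_of_rel hm (c i)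
    have hrn := rel_res_of_rel hn (c i)
    rw [hk i] at hrm hrn
    obtain ⟨m', hm', hlem⟩ := exists_extend hrm
    obtain ⟨n', hn', hlen⟩ := exists_extend hrn
    have hsm := isCondSeq_iff.1 (p i).2.1 (c i) m m' hm'.symm
    have hsn := isCondSeq_iff.1 (p i).2.1 (c i) n n' hn'.symm
    exact qabs_sub_lt_iff.1 (hn₀ i m' n' hlem hlen) (b ⊓ c i) hi e₁ e₂ e'
      (le_coeff_congr ((hq m i).trans hsm) inf_le_right (inf_le_left.trans he₁))
      (le_coeff_congr ((hq n i).trans hsn) inf_le_right (inf_le_left.trans he₂))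
      (inf_le_left.trans he')
  refine ⟨⟨q, hqs, hqc⟩, fun i => ?_⟩
  intro ε hε
  refine ⟨pure A 0, fun n _ => ?_⟩
  rw [qabs_lt_iff]
  intro b hbi hb g e hg he
  obtain ⟨d, hdb, hd, x, hx⟩ := exists_dec (q n) hb
  have hx' := le_coeff_congr (hq n i) (hdb.trans hbi) hx
  rw [eq_of_le hd (hdb.trans hg) (le_coeff_sub hx hx'), sub_self, abs_zero]
  exact pos_iff.1 hε b hb e he

end CondReal

open CondReal in
/-- The conditional real numbers: `R_a` consists of the conditional Cauchy sequences of conditional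
rationals modulo equivalence on `a`. (Every conditional Cauchy sequence on `a` is the restriction
of one on `1`.) -/
def condReal.{u} (A : Type u) [CompleteBooleanAlgebra A] : CondSet.{u, u} A where
  obj a := cauchySeq A ⧸ nullIdeal a
  res a := Ideal.Quotient.factor (nullIdeal_anti le_top)
  bot_singleton := by
    refine ⟨0, fun y => ?_⟩
    obtain ⟨s, rfl⟩ := Ideal.Quotient.mk_surjective y
    rw [Ideal.Quotient.eq_zero_iff_mem]
    intro ε hε
    refine ⟨Gen.pure A 0, fun n _ => ?_⟩
    rw [qabs_lt_iff]
    exact fun c hc hc' => absurd (le_bot_iff.1 hc) hc'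
  res_surjective a := Ideal.Quotient.factor_surjective _
  res_top x := by
    obtain ⟨s, rfl⟩ := Ideal.Quotient.mk_surjective x
    rfl
  consistency {a b} h x y hxy := by
    obtain ⟨s, rfl⟩ := Ideal.Quotient.mk_surjective x
    obtain ⟨t, rfl⟩ := Ideal.Quotient.mk_surjective y
    exact Ideal.Quotient.eq.2 (nullIdeal_anti h (Ideal.Quotient.eq.1 hxy))
  stability {ι} c hc x := by
    choose p hp using fun i => Ideal.Quotient.mk_surjective (x i)
    obtain ⟨q, hq⟩ := exists_amalgam hc p
    refine ⟨Ideal.Quotient.mk _ q, fun i => ?_, fun y hy => ?_⟩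
    · rw [← hp i]
      exact Ideal.Quotient.eq.2 (hq i)
    · obtain ⟨t, rfl⟩ := Ideal.Quotient.mk_surjective y
      refine Ideal.Quotient.eq.2 (isNull_of_partition hc (t - q).2.1 fun i => ?_)
      have h1 : Ideal.Quotient.mk (nullIdeal (c i)) t = Ideal.Quotient.mk _ q := by
        have := hy i
        rw [← hp i] at this
        exact this.trans (Ideal.Quotient.eq.2 (hq i)).symm
      exact Ideal.Quotient.eq.1 h1

namespace CondReal

open Gen

universe u

variable {A : Type u} [CompleteBooleanAlgebra A]

instance (a : A) : CommRing ((condReal A).obj a) :=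
  inferInstanceAs (CommRing (cauchySeq A ⧸ nullIdeal a))

/-- The class of a conditional Cauchy sequence. -/
def mk (p : cauchySeq A) : (condReal A).obj ⊤ := Ideal.Quotient.mk (nullIdeal ⊤) p

/-- The conditional order: `[(p_n)] ≤ [(q_n)]` if for every conditional rational `ε > 0` one has
`q_n - p_n > -ε` for all `n ≥ n₀`, for some `n₀`. -/
instance : LE ((condReal A).obj ⊤) where
  le x y := ∃ p q : cauchySeq A, mk p = x ∧ mk q = y ∧
    ∀ ε : (gen A ℚ).obj ⊤, Rel (· < ·) 0 ε → ∃ n₀ : (gen A ℕ).obj ⊤, ∀ n, Rel (· ≤ ·) n₀ n →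
      Rel (· < ·) (-ε) (q.1 n - p.1 n)

/-- The condition defining the order does not depend on the chosen representatives. -/
theorem mk_le_mk {p q : cauchySeq A} : mk p ≤ mk q ↔
    ∀ ε : (gen A ℚ).obj ⊤, Rel (· < ·) 0 ε → ∃ n₀ : (gen A ℕ).obj ⊤, ∀ n, Rel (· ≤ ·) n₀ n →
      Rel (· < ·) (-ε) (q.1 n - p.1 n) := by
  refine ⟨?_, fun h => ⟨p, q, rfl, rfl, h⟩⟩
  rintro ⟨p', q', hp, hq, h⟩ ε hε
  have hpos : ∀ q : ℚ, 0 < q → 0 < q / 3 := fun q h => by positivity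
  have hε' := pos_map (fun q => q / 3) hpos hε
  obtain ⟨n₁, h₁⟩ := h _ hε'
  obtain ⟨n₂, h₂⟩ := (Ideal.Quotient.eq.1 hp : IsNull ⊤ (p'.1 - p.1)) _ hε'
  obtain ⟨n₃, h₃⟩ := (Ideal.Quotient.eq.1 hq : IsNull ⊤ (q'.1 - q.1)) _ hε'
  obtain ⟨k₁, hk₁⟩ := exists_ub n₁ n₂
  obtain ⟨k, hk⟩ := exists_ub k₁ n₃
  refine ⟨k, fun n hn => ?_⟩
  rw [rel_iff]
  intro c hc e g he hg
  obtain ⟨d₁, hd₁, hb₁, x, hx⟩ := exists_dec (p.1 n) hc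
  obtain ⟨d₂, hd₂, hb₂, x', hx'⟩ := exists_dec (p'.1 n) hb₁
  obtain ⟨d₃, hd₃, hb₃, y, hy⟩ := exists_dec (q.1 n) hb₂
  obtain ⟨d₄, hd₄, hb₄, y', hy'⟩ := exists_dec (q'.1 n) hb₃
  obtain ⟨d, hd, hb, r, hr⟩ := exists_dec ε hb₄
  have l₃ : d ≤ d₃ := hd.trans hd₄
  have l₂ : d ≤ d₂ := l₃.trans hd₃
  have l₁ : d ≤ d₁ := l₂.trans hd₂
  have l₀ : d ≤ c := l₁.trans hd₁
  have hx := l₁.trans hx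
  have hx' := l₂.trans hx'
  have hy := l₃.trans hy
  have hy' := hd.trans hy'
  have hr3 := le_coeff_map (fun q : ℚ => q / 3) hr
  rw [eq_of_le hb (l₀.trans he) (le_coeff_map (- ·) hr),
    eq_of_le hb (l₀.trans hg) (le_coeff_sub hy hx)]
  have i₁ := rel_iff.1 (h₁ n (hk₁ _ (hk _ hn).1).1) d hb _ _ (le_coeff_map (- ·) hr3)
    (le_coeff_sub hy' hx')
  have i₂ := qabs_lt_iff.1 (h₂ n (hk₁ _ (hk _ hn).1).2) d le_top hb _ _ (le_coeff_sub hx' hx) hr3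
  have i₃ := qabs_lt_iff.1 (h₃ n (hk _ hn).2) d le_top hb _ _ (le_coeff_sub hy' hy) hr3
  have j₂ := abs_lt.1 i₂
  have j₃ := abs_lt.1 i₃
  change -r < y - x
  change -(r / 3) < y' - x' at i₁
  linarith [j₂.1, j₂.2, j₃.1, j₃.2]

instance : CondRing (condReal A) where
  add_cond := by
    refine ⟨CondFun.ofPrimal (fun p => p.1 + p.2) ?_, fun x y => CondFun.ofPrimal_apply _ _ _⟩
    intro a p q h
    change Ideal.Quotient.factor _ _ = Ideal.Quotient.factor _ _
    have h1 := congrArg Prod.fst h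
    have h2 := congrArg Prod.snd h
    refine (map_add (Ideal.Quotient.factor (nullIdeal_anti (le_top (a := a)))) _ _).trans
      (Eq.trans ?_ (map_add (Ideal.Quotient.factor (nullIdeal_anti (le_top (a := a)))) _ _).symm)
    exact congrArg₂ (· + ·) h1 h2
  mul_cond := by
    refine ⟨CondFun.ofPrimal (fun p => p.1 * p.2) ?_, fun x y => CondFun.ofPrimal_apply _ _ _⟩
    intro a p q h
    change Ideal.Quotient.factor _ _ = Ideal.Quotient.factor _ _
    have h1 := congrArg Prod.fst h
    have h2 := congrArg Prod.snd h
    refine (map_mul (Ideal.Quotient.factor (nullIdeal_anti (le_top (a := a)))) _ _).trans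
      (Eq.trans ?_ (map_mul (Ideal.Quotient.factor (nullIdeal_anti (le_top (a := a)))) _ _).symm)
    exact congrArg₂ (· * ·) h1 h2

end CondReal

end

/-! The primal ring of the conditional reals is in general neither a field nor totally ordered, so
the extension step, which divides by scalars and distinguishes their signs, is not run over it.
Scalars are first restricted to the classical rationals. A conditionally convex `k` is convex for
rational weights, and the conditional reals form an ordered rational vector space in which non-empty
bounded sets have suprema (`CondReal.exists_isLUB`). The classical argument then yields a rationally
linear extension `g ≤ k`, which so far ignores the conditional structure.

That structure is recovered from the domination by `k`. Locality: if `x` vanishes on `a`, then `k (n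
• x)` agrees on `a` with `k 0` for every integer `n`, so all integer multiples of the part of `g x`
on `a` lie below one bound, and the Archimedean property makes that part zero
(`CondReal.resHom_eq_zero_of_le`). Hence `g` is a conditional function. Since a conditional rational
is glued from classical ones, locality turns rational linearity into linearity for conditional
rationals. Real scalars: `l ↦ g (l • x) - l * g x` is additive, vanishes on conditional rationals,
and is bounded above on `[-1, 1]` by convexity; density and the Archimedean property make it zero
(`CondReal.map_smul_of_map_ofGen_smul`).

Order completeness rests on `Gen.exists_selection`: a classical rational chosen densely in the
algebra can be glued to a conditional one. This gives upper bounds that are least up to `1 / (n +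
1)`, and these converge to the supremum. -/

section HahnBanach

/-! ### Classical Hahn–Banach extension with order-complete values and a convex majorant. -/

variable {𝕜 E F : Type*} [Field 𝕜] [LinearOrder 𝕜] [IsStrictOrderedRing 𝕜]
  [AddCommGroup E] [Module 𝕜 E]
  [AddCommGroup F] [PartialOrder F] [IsOrderedAddMonoid F] [Module 𝕜 F] [PosSMulMono 𝕜 F]

/-- One-dimensional extension step for the Hahn-Banach theorem with values in an ordered vector
space in which non-empty bounded sets have suprema. -/
theorem LinearPMap.exists_lt_of_le_convex
    (hF : ∀ s : Set F, s.Nonempty → BddAbove s → ∃ a, IsLUB s a)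
    {k : E → F} (hk : ConvexOn 𝕜 Set.univ k) (f : E →ₗ.[𝕜] F) (hf : ∀ x : f.domain, f x ≤ k x)
    (hdom : f.domain ≠ ⊤) : ∃ g, f < g ∧ ∀ x : g.domain, g x ≤ k x := by
  obtain ⟨y, -, hy⟩ : ∃ y ∈ ⊤, y ∉ f.domain := SetLike.exists_of_lt (lt_top_iff_ne_top.2 hdom)
  -- The two sides are a lower and an upper constraint on the value to be assigned to `y`. The
  -- convex combination with weights `t / (s + t)` and `s / (s + t)` cancels `y`, so it lies in the
  -- domain, where `f ≤ k` is known.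
  have key : ∀ (d d' : f.domain) (s t : 𝕜), 0 < s → 0 < t →
      s⁻¹ • (f d - k ((d : E) - s • y)) ≤ t⁻¹ • (k ((d' : E) + t • y) - f d') := by
    intro d d' s t hs ht
    have hst : 0 < s + t := add_pos hs ht
    have h1 := hk.2 (Set.mem_univ ((d : E) - s • y)) (Set.mem_univ ((d' : E) + t • y))
      (div_nonneg ht.le hst.le) (div_nonneg hs.le hst.le) (by field_simp; ring)
    have h2 := hf ((t / (s + t)) • d + (s / (s + t)) • d')
    have h3 : ((((t / (s + t)) • d + (s / (s + t)) • d' : f.domain)) : E) =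
        (t / (s + t)) • ((d : E) - s • y) + (s / (s + t)) • ((d' : E) + t • y) := by
      push_cast
      rw [smul_sub, smul_add, smul_smul, smul_smul, show t / (s + t) * s = s / (s + t) * t by ring]
      abel
    rw [h3, LinearPMap.map_add, LinearPMap.map_smul, LinearPMap.map_smul] at h2
    -- The factor `(s + t) / (s * t)` turns the two weights into `s⁻¹` and `t⁻¹`.
    have h4 := smul_le_smul_of_nonneg_left (sub_nonneg.2 (h2.trans h1))
      (show 0 ≤ (s + t) / (s * t) by positivity)
    rw [smul_zero] at h4
    rw [← sub_nonneg]
    convert h4 using 1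
    simp only [smul_sub, smul_add, smul_smul]
    rw [show (s + t) / (s * t) * (t / (s + t)) = s⁻¹ by field_simp,
      show (s + t) / (s * t) * (s / (s + t)) = t⁻¹ by field_simp]
    abel
  -- The supremum of all lower constraints serves as the value at `y`; the upper constraint with `d'
  -- = 0`, `t = 1` bounds them.
  obtain ⟨α, hα⟩ := hF (Set.range fun p : f.domain × {s : 𝕜 // 0 < s} =>
      (p.2 : 𝕜)⁻¹ • (f p.1 - k ((p.1 : E) - (p.2 : 𝕜) • y))) ⟨_, (0, ⟨1, one_pos⟩), rfl⟩
    ⟨_, by rintro _ ⟨p, rfl⟩; exact key p.1 0 p.2.1 1 p.2.2 one_pos⟩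
  have le_α : ∀ (d : f.domain) (s : 𝕜), 0 < s → s⁻¹ • (f d - k ((d : E) - s • y)) ≤ α :=
    fun d s hs => hα.1 ⟨(d, ⟨s, hs⟩), rfl⟩
  have α_le : ∀ (d : f.domain) (s : 𝕜), 0 < s → α ≤ s⁻¹ • (k ((d : E) + s • y) - f d) := by
    intro d s hs
    refine hα.2 ?_
    rintro _ ⟨p, rfl⟩
    exact key p.1 d p.2.1 s p.2.2 hs
  refine ⟨f.supSpanSingleton y α hy, ?_, ?_⟩
  · refine lt_iff_le_not_ge.2 ⟨f.left_le_sup _ _, fun H => ?_⟩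
    replace H := LinearPMap.domain_mono.monotone H
    rw [LinearPMap.domain_supSpanSingleton, sup_le_iff, Submodule.span_le,
      Set.singleton_subset_iff] at H
    exact hy H.2
  · rintro ⟨z, hz⟩
    rcases Submodule.mem_sup.1 hz with ⟨d, hd, y', hy', rfl⟩
    rcases Submodule.mem_span_singleton.1 hy' with ⟨r, rfl⟩
    rw [LinearPMap.supSpanSingleton_apply_mk _ _ _ _ _ hd, RingHom.id_apply]
    -- For `r < 0` the lower constraint with `s = -r` is used, for `r > 0` the upper one with `s =
    -- r`.
    rcases lt_trichotomy r 0 with hr | rfl | hr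
    · have h := smul_le_smul_of_nonneg_left (le_α ⟨d, hd⟩ (-r) (neg_pos.2 hr)) (neg_pos.2 hr).le
      rw [smul_smul, mul_inv_cancel₀ (neg_pos.2 hr).ne', one_smul, neg_smul, neg_smul,
        sub_neg_eq_add, sub_le_iff_le_add, ← sub_eq_neg_add, le_sub_iff_add_le] at h
      exact h
    · simpa using hf ⟨d, hd⟩
    · have h := smul_le_smul_of_nonneg_left (α_le ⟨d, hd⟩ r hr) hr.le
      rw [smul_smul, mul_inv_cancel₀ hr.ne', one_smul, le_sub_iff_add_le'] at h
      exact h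

/-- The Hahn-Banach theorem with values in an ordered vector space in which non-empty bounded sets
have suprema, for a convex majorant. -/
theorem LinearPMap.exists_extension_of_le_convex
    (hF : ∀ s : Set F, s.Nonempty → BddAbove s → ∃ a, IsLUB s a)
    {k : E → F} (hk : ConvexOn 𝕜 Set.univ k) (f : E →ₗ.[𝕜] F) (hf : ∀ x : f.domain, f x ≤ k x) :
    ∃ g : E →ₗ[𝕜] F, (∀ x, g x ≤ k x) ∧ ∀ x : f.domain, g x = f x := by
  have hSc : ∀ c ⊆ {p : E →ₗ.[𝕜] F | ∀ x : p.domain, p x ≤ k x}, IsChain (· ≤ ·) c → ∀ y ∈ c,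
      ∃ ub ∈ {p : E →ₗ.[𝕜] F | ∀ x : p.domain, p x ≤ k x}, ∀ z ∈ c, z ≤ ub := by
    intro c hcs c_chain y hy
    have hcd : DirectedOn (· ≤ ·) c := c_chain.directedOn
    refine ⟨LinearPMap.sSup c hcd, ?_, fun _ ↦ LinearPMap.le_sSup hcd⟩
    rintro ⟨x, hx⟩
    have hdir : DirectedOn (· ≤ ·) (LinearPMap.domain '' c) :=
      directedOn_image.2 (hcd.mono LinearPMap.domain_mono.monotone)
    rcases (Submodule.mem_sSup_of_directed (Set.Nonempty.image _ ⟨y, hy⟩) hdir).1 hx with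
      ⟨_, ⟨p, hpc, rfl⟩, hpx⟩
    have h := hcs hpc ⟨x, hpx⟩
    rwa [← LinearPMap.sSup_apply hcd hpc] at h
  obtain ⟨q, hfq, hq⟩ := zorn_le_nonempty₀ _ hSc f hf
  have htop : q.domain = ⊤ := by
    by_contra h
    obtain ⟨r, hqr, hr⟩ := q.exists_lt_of_le_convex hF hk hq.1 h
    exact hqr.not_ge (hq.2 hr hqr.le)
  refine ⟨q.toFun ∘ₗ (LinearMap.id.codRestrict q.domain fun x => htop ▸ Submodule.mem_top),
    fun x => hq.1 _, fun x => ?_⟩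
  exact (hfq.2 rfl).symm

end HahnBanach

/-! ### Gluing dense local choices. -/

section Selection

universe u v

variable {A : Type u} [CompleteBooleanAlgebra A]

open Gen

/-- A hereditary and dense relation between conditions and elements of a countable set `E` has a
selection in the conditional set generated by `E`. -/
theorem Gen.exists_selection {E : Type v} [Nonempty E] [Countable E] (P : A → E → Prop)
    (hmono : ∀ c d e, d ≤ c → P c e → P d e)
    (hdense : ∀ c, c ≠ ⊥ → ∃ d ≤ c, d ≠ ⊥ ∧ ∃ e, P d e) :
    ∃ x : (gen A E).obj ⊤, ∀ c, c ≠ ⊥ → ∀ e, c ≤ coeff x e → ∃ d ≤ c, d ≠ ⊥ ∧ P d e := by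
  obtain ⟨f, hf⟩ := exists_surjective_nat E
  -- `P` need not hold on this supremum itself, only densely below it; this is why the conclusion
  -- passes to a smaller `d`.
  let a : ℕ → A := fun n => ⨆ c : {c : A // P c (f n)}, c.1
  have ha : ∀ n c, c ≠ ⊥ → c ≤ a n → ∃ d ≤ c, d ≠ ⊥ ∧ P d (f n) := by
    intro n c hc hca
    by_contra! hcon
    refine hc ?_
    rw [← inf_eq_left.2 hca, inf_iSup_eq, iSup_eq_bot]
    rintro ⟨d, hd⟩
    by_contra hne
    exact hcon (c ⊓ d) inf_le_left hne (hmono d _ _ inf_le_right hd)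
  have htop : ⨆ n, a n = ⊤ := by
    by_contra hne
    obtain ⟨d, hd, hd0, e, he⟩ := hdense _ (mt compl_eq_bot.1 hne)
    obtain ⟨n, rfl⟩ := hf e
    have h1 : d ≤ ⨆ n, a n := le_iSup_of_le n (le_iSup (fun c : {c : A // P c (f n)} => c.1) ⟨d, he⟩)
    exact hd0 (le_bot_iff.1 (compl_inf_eq_bot (a := ⨆ n, a n) ▸ le_inf hd h1))
  -- Giving each condition to the first index that covers it yields a partition. Since `f` need not
  -- be injective, the choice is made over `ℕ` and pushed forward along `f`.
  let x : (gen A ℕ).obj ⊤ := ⟨disjointed a, disjoint_disjointed a, (iSup_disjointed a).trans htop⟩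
  refine ⟨map f x, fun c hc e he => ?_⟩
  obtain ⟨d, hdc, hd, n, hn⟩ := exists_dec x hc
  obtain ⟨d', hd', hd0, h⟩ := ha n d hd (hn.trans (disjointed_le a n))
  rw [eq_of_le hd (hdc.trans he) (le_coeff_map f hn)]
  exact ⟨d', hd'.trans hdc, hd0, h⟩

end Selection

/-! ### The conditional reals as an Archimedean ordered ring. -/

namespace CondReal

open Gen

universe u

variable {A : Type u} [CompleteBooleanAlgebra A]

/-- Densely in `A`, the property `φ` holds hereditarily for all large natural numbers. -/
def DenselyEventually (φ : A → ℕ → Prop) : Prop :=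
  ∀ c, c ≠ ⊥ → ∃ d ≤ c, d ≠ ⊥ ∧ ∃ k, ∀ j, k ≤ j → ∀ d' ≤ d, d' ≠ ⊥ → φ d' j

/-- The implication may use `φ` on every smaller non-zero condition, because a value of a sum or
product splits into values of its arguments only after shrinking. -/
theorem DenselyEventually.mono {φ ψ : A → ℕ → Prop} (h : DenselyEventually φ)
    (hi : ∀ d, d ≠ ⊥ → ∀ j, (∀ d' ≤ d, d' ≠ ⊥ → φ d' j) → ψ d j) : DenselyEventually ψ := by
  intro c hc
  obtain ⟨d, hdc, hd, k, hk⟩ := h c hc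
  exact ⟨d, hdc, hd, k, fun j hj d' hd' h0 => hi d' h0 j fun b hb =>
    hk j hj b (hb.trans hd')⟩

theorem DenselyEventually.and {φ ψ : A → ℕ → Prop} (h : DenselyEventually φ)
    (h' : DenselyEventually ψ) : DenselyEventually fun d j => φ d j ∧ ψ d j := by
  intro c hc
  obtain ⟨d, hdc, hd, k, hk⟩ := h c hc
  obtain ⟨d', hdc', hd', k', hk'⟩ := h' d hd
  exact ⟨d', hdc'.trans hdc, hd', max k k', fun j hj b hb h0 =>
    ⟨hk j (le_of_max_le_left hj) b (hb.trans hdc') h0, hk' j (le_of_max_le_right hj) b hb h0⟩⟩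

theorem pos_pure {r : ℚ} (hr : 0 < r) : Rel (· < ·) (0 : (gen A ℚ).obj ⊤) (pure A r) := by
  rw [pos_iff]
  intro c hc e he
  rwa [eq_of_le hc he (le_coeff_pure c r)]

theorem res_eq_of_le_coeff {E : Type*} [Nonempty E] {c : A} {x y : (gen A E).obj ⊤} {e : E}
    (hx : c ≤ coeff x e) (hy : c ≤ coeff y e) : (gen A E).res c x = (gen A E).res c y := by
  rw [res_eq_iff]
  intro d hdc hd e₁ e₂ h₁ h₂
  rw [eq_of_le hd h₁ (hdc.trans hx), eq_of_le hd h₂ (hdc.trans hy)]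

/-- On a condition where `n` has the value `j`, a conditional sequence takes the same values at
`n` and at `j`. -/
theorem le_coeff_seq (p : cauchySeq A) {n m : (gen A ℕ).obj ⊤} {c : A} {j : ℕ} {e : ℚ}
    (hn : c ≤ coeff n j) (hm : c ≤ coeff m j) (he : c ≤ coeff (p.1 n) e) : c ≤ coeff (p.1 m) e :=
  le_coeff_congr (isCondSeq_iff.1 p.2.1 c n m (res_eq_of_le_coeff hn hm)) le_rfl he

/-- If `n₀` has the value `k ≤ j` on `d`, then some `n` with `n₀ ≤ n` has the value `j` on `d`. -/
theorem exists_rel_le {n₀ : (gen A ℕ).obj ⊤} {d : A} {k j : ℕ} (hk : d ≤ coeff n₀ k)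
    (hj : k ≤ j) : ∃ n, Rel (· ≤ ·) n₀ n ∧ d ≤ coeff n j := by
  obtain ⟨n, hn, hle⟩ := exists_extend (b := d) (n₀ := n₀) (n := pure A j)
    (rel_res_iff.2 fun b hb hb0 i i' hi hi' => by
      rw [eq_of_le hb0 hi (hb.trans hk), eq_of_le hb0 hi' (le_coeff_pure b j)]
      exact hj)
  exact ⟨n, hle, le_coeff_congr hn.symm le_rfl (le_coeff_pure d j)⟩

theorem zero_le_mk_iff {p : cauchySeq A} : 0 ≤ mk p ↔
    ∀ ε : (gen A ℚ).obj ⊤, Rel (· < ·) 0 ε → ∃ n₀ : (gen A ℕ).obj ⊤, ∀ n, Rel (· ≤ ·) n₀ n →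
      Rel (· < ·) (-ε) (p.1 n) := by
  have h : (0 : (condReal A).obj ⊤) = mk 0 := rfl
  rw [h, mk_le_mk]
  have h2 : ∀ n, p.1 n - (0 : cauchySeq A).1 n = p.1 n := fun n => sub_zero _
  simp only [h2]

/-- Non-negativity of a conditional real number in terms of classical sequences. -/
theorem zero_le_mk_iff_denselyEventually {p : cauchySeq A} : 0 ≤ mk p ↔
    ∀ r : ℚ, 0 < r → DenselyEventually fun d j => ∀ e, d ≤ coeff (p.1 (pure A j)) e → -r < e := by
  rw [zero_le_mk_iff]
  constructor
  · intro h r hr c hc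
    obtain ⟨n₀, hn₀⟩ := h _ (pos_pure hr)
    obtain ⟨d, hdc, hd, k, hk⟩ := exists_dec n₀ hc
    refine ⟨d, hdc, hd, k, fun j hj d' hd' h0 e he => ?_⟩
    obtain ⟨n, hle, hn⟩ := exists_rel_le hk hj
    have hnj := hd'.trans hn
    exact rel_iff.1 (hn₀ n hle) d' h0 _ e (le_coeff_map (- ·) (le_coeff_pure d' r))
      (le_coeff_seq p (le_coeff_pure d' j) hnj he)
  · intro h ε hε
    -- Both the value `r` of `ε` and the threshold `k` belonging to it vary with the condition; `n₀`
    -- glues these thresholds.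
    obtain ⟨n₀, hn₀⟩ := exists_selection (A := A) (E := ℕ)
      (fun d k => ∃ r, d ≤ coeff ε r ∧ ∀ j, k ≤ j → ∀ d' ≤ d, d' ≠ ⊥ → ∀ e,
        d' ≤ coeff (p.1 (pure A j)) e → -r < e)
      (fun c d k hdc ⟨r, hr, h⟩ => ⟨r, hdc.trans hr, fun j hj d' hd' => h j hj d' (hd'.trans hdc)⟩)
      (by
        intro c hc
        obtain ⟨c', hcc', hc', r, hr⟩ := exists_dec ε hc
        obtain ⟨d, hdc, hd, k, hk⟩ := h r (pos_iff.1 hε c' hc' r hr) c' hc'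
        exact ⟨d, hdc.trans hcc', hd, k, r, hdc.trans hr, hk⟩)
    refine ⟨n₀, fun n hn => ?_⟩
    rw [rel_iff]
    intro c hc g e hg he
    obtain ⟨c₁, hc₁, hb₁, k, hk⟩ := exists_dec n₀ hc
    obtain ⟨c₂, hc₂, hb₂, j, hj⟩ := exists_dec n hb₁
    obtain ⟨d, hd, hd0, r, hr, hφ⟩ := hn₀ c₂ hb₂ k (hc₂.trans hk)
    have hdc : d ≤ c := hd.trans (hc₂.trans hc₁)
    rw [eq_of_le hd0 (hdc.trans hg) (le_coeff_map (- ·) hr)]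
    exact hφ j (rel_iff.1 hn c₂ hb₂ k j (hc₂.trans hk) hj) d le_rfl hd0 e
      (le_coeff_seq p (hd.trans hj) (le_coeff_pure d j) (hdc.trans he))

theorem mk_surjective : Function.Surjective (mk (A := A)) := Ideal.Quotient.mk_surjective

/-- This reduces the order axioms to closure properties of the cone of non-negative elements. -/
theorem le_iff_zero_le_sub {x y : (condReal A).obj ⊤} : x ≤ y ↔ 0 ≤ y - x := by
  obtain ⟨p, rfl⟩ := mk_surjective x
  obtain ⟨q, rfl⟩ := mk_surjective y
  have h : mk q - mk p = mk (q - p) := rfl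
  rw [h, mk_le_mk, zero_le_mk_iff]
  rfl

theorem exists_of_le_coeff_map {E F : Type*} [Nonempty E] [Nonempty F] (f : E → F)
    {x : (gen A E).obj ⊤} {c : A} (hc : c ≠ ⊥) {g : F} (h : c ≤ coeff (map f x) g) :
    ∃ d ≤ c, d ≠ ⊥ ∧ ∃ e, d ≤ coeff x e ∧ g = f e := by
  obtain ⟨d, hd, hb, e, he⟩ := exists_dec x hc
  exact ⟨d, hd, hb, e, he, eq_of_le hb (hd.trans h) (le_coeff_map f he)⟩

theorem exists_of_le_coeff_map₂ {E F G : Type*} [Nonempty E] [Nonempty F] [Nonempty G]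
    (f : E → F → G) {x : (gen A E).obj ⊤} {y : (gen A F).obj ⊤} {c : A} (hc : c ≠ ⊥) {g : G}
    (h : c ≤ coeff (map₂ f x y) g) :
    ∃ d ≤ c, d ≠ ⊥ ∧ ∃ e e', d ≤ coeff x e ∧ d ≤ coeff y e' ∧ g = f e e' := by
  obtain ⟨d₁, hd₁, hb₁, e, he⟩ := exists_dec x hc
  obtain ⟨d, hd, hb, e', he'⟩ := exists_dec y hb₁
  exact ⟨d, hd.trans hd₁, hb, e, e', hd.trans he, he',
    eq_of_le hb ((hd.trans hd₁).trans h) (le_coeff_map₂ f (hd.trans he) he')⟩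

theorem le_coeff_nsmul {x : (gen A ℚ).obj ⊤} {c : A} {e : ℚ} (h : c ≤ coeff x e) (m : ℕ) :
    c ≤ coeff (m • x) (m * e) := by
  induction m with
  | zero => simpa using le_coeff_zero c
  | succ m ih =>
    rw [succ_nsmul, Nat.cast_succ, add_mul, one_mul]
    exact le_coeff_map₂ (· + ·) ih h

theorem zero_le_add {x y : (condReal A).obj ⊤} (hx : 0 ≤ x) (hy : 0 ≤ y) : 0 ≤ x + y := by
  obtain ⟨p, rfl⟩ := mk_surjective x
  obtain ⟨q, rfl⟩ := mk_surjective y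
  have h : mk p + mk q = mk (p + q) := rfl
  rw [h, zero_le_mk_iff_denselyEventually]
  rw [zero_le_mk_iff_denselyEventually] at hx hy
  intro r hr
  refine ((hx (r / 2) (half_pos hr)).and (hy (r / 2) (half_pos hr))).mono ?_
  intro d hd j h e he
  obtain ⟨b, hbd, hb, u, v, hu, hv, rfl⟩ := exists_of_le_coeff_map₂ (· + ·) hd he
  have i₁ := (h b hbd hb).1 u hu
  have i₂ := (h b hbd hb).2 v hv
  change -r < u + v
  linarith

/-- The conditional bound and the conditional index from which it holds both become classical on a
smaller condition. -/
theorem exists_bound (p : cauchySeq A) {c : A} (hc : c ≠ ⊥) : ∃ d ≤ c, d ≠ ⊥ ∧ ∃ M : ℚ, 0 < M ∧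
    ∃ k, ∀ j, k ≤ j → ∀ d' ≤ d, d' ≠ ⊥ → ∀ e, d' ≤ coeff (p.1 (pure A j)) e → |e| < M := by
  obtain ⟨B, hB, n₀, h⟩ := p.2.2.bounded
  obtain ⟨d₁, hd₁, hb₁, M, hM⟩ := exists_dec B hc
  obtain ⟨d, hd, hb, k, hk⟩ := exists_dec n₀ hb₁
  refine ⟨d, hd.trans hd₁, hb, M, pos_iff.1 hB d₁ hb₁ M hM, k, fun j hj d' hd' h0 e he => ?_⟩
  obtain ⟨n, hle, hn⟩ := exists_rel_le hk hj
  have hnj := hd'.trans hn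
  exact h n hle d' h0 e M (le_coeff_seq p (le_coeff_pure d' j) hnj he) ((hd'.trans hd).trans hM)

theorem zero_le_mul {x y : (condReal A).obj ⊤} (hx : 0 ≤ x) (hy : 0 ≤ y) : 0 ≤ x * y := by
  obtain ⟨p, rfl⟩ := mk_surjective x
  obtain ⟨q, rfl⟩ := mk_surjective y
  have h : mk p * mk q = mk (p * q) := rfl
  rw [h, zero_le_mk_iff_denselyEventually]
  rw [zero_le_mk_iff_denselyEventually] at hx hy
  intro r hr c hc
  obtain ⟨d₁, hd₁, hb₁, M, hM, k₁, hk₁⟩ := exists_bound p hc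
  obtain ⟨d₂, hd₂, hb₂, N, hN, k₂, hk₂⟩ := exists_bound q hb₁
  -- Only factors of opposite sign matter: their product is at least `-δ * M` or `-δ * N`, and both
  -- exceed `-r` because `δ * (M + N) = r`.
  have hδ : 0 < r / (M + N) := by positivity
  obtain ⟨d₃, hd₃, hb₃, k₃, hk₃⟩ := ((hx _ hδ).and (hy _ hδ)) d₂ hb₂
  refine ⟨d₃, (hd₃.trans hd₂).trans hd₁, hb₃, max k₁ (max k₂ k₃), fun j hj d hd h0 e he => ?_⟩
  obtain ⟨b, hbd, hb, u, v, hu, hv, rfl⟩ := exists_of_le_coeff_map₂ (· * ·) h0 he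
  have l₃ : b ≤ d₃ := hbd.trans hd
  have l₂ : b ≤ d₂ := l₃.trans hd₃
  obtain ⟨i₁, i₂⟩ := hk₃ j (by omega) b l₃ hb
  have i₁ := i₁ u hu
  have i₂ := i₂ v hv
  have j₁ := abs_lt.1 (hk₁ j (by omega) b (l₂.trans hd₂) hb u hu)
  have j₂ := abs_lt.1 (hk₂ j (by omega) b l₂ hb v hv)
  have hr' : r = r / (M + N) * M + r / (M + N) * N := by field_simp
  set δ := r / (M + N)
  have p₁ : 0 < δ * M := by positivity
  have p₂ : 0 < δ * N := by positivity
  change -r < u * v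
  rcases le_total 0 u with hu0 | hu0 <;> rcases le_total 0 v with hv0 | hv0
  · have := mul_nonneg hu0 hv0
    linarith
  · have := mul_le_mul_of_nonneg_left i₂.le hu0
    have := mul_le_mul_of_nonneg_left j₁.2.le hδ.le
    linarith
  · have := mul_le_mul_of_nonneg_right i₁.le hv0
    have := mul_le_mul_of_nonneg_left j₂.2.le hδ.le
    linarith
  · have := mul_nonneg_of_nonpos_of_nonpos hu0 hv0
    linarith

/-- On any condition both factors take the same rational value. As the order need not be total,
squares later stand in for absolute values and maxima. -/
theorem zero_le_mul_self (x : (condReal A).obj ⊤) : 0 ≤ x * x := by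
  obtain ⟨p, rfl⟩ := mk_surjective x
  have h : mk p * mk p = mk (p * p) := rfl
  rw [h, zero_le_mk_iff_denselyEventually]
  refine fun r hr c hc => ⟨c, le_rfl, hc, 0, fun j _ d _ hd e he => ?_⟩
  obtain ⟨b, hbd, hb, u, v, hu, hv, rfl⟩ := exists_of_le_coeff_map₂ (· * ·) hd he
  obtain rfl := eq_of_le hb hu hv
  exact (neg_neg_of_pos hr).trans_le (mul_self_nonneg u)

theorem eq_zero_of_zero_le_of_zero_le_neg {x : (condReal A).obj ⊤} (hx : 0 ≤ x) (hx' : 0 ≤ -x) :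
    x = 0 := by
  obtain ⟨p, rfl⟩ := mk_surjective x
  have h : -mk p = mk (-p) := rfl
  rw [h, zero_le_mk_iff] at hx'
  rw [zero_le_mk_iff] at hx
  refine Ideal.Quotient.eq_zero_iff_mem.2 fun ε hε => ?_
  obtain ⟨n₁, h₁⟩ := hx ε hε
  obtain ⟨n₂, h₂⟩ := hx' ε hε
  obtain ⟨k, hk⟩ := exists_ub n₁ n₂
  refine ⟨k, fun n hn => ?_⟩
  rw [qabs_lt_iff]
  intro c _ hc e r he hr
  have i₁ := rel_iff.1 (h₁ n (hk n hn).1) c hc _ _ (le_coeff_map (- ·) hr) he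
  have i₂ := rel_iff.1 (h₂ n (hk n hn).2) c hc _ _ (le_coeff_map (- ·) hr) (le_coeff_map (- ·) he)
  exact abs_lt.2 ⟨i₁, neg_lt_neg_iff.1 i₂⟩

instance : PartialOrder ((condReal A).obj ⊤) where
  le_refl x := by
    rw [le_iff_zero_le_sub, sub_self]
    simpa using zero_le_mul_self (0 : (condReal A).obj ⊤)
  le_trans x y z hxy hyz := by
    rw [le_iff_zero_le_sub] at *
    simpa using zero_le_add hyz hxy
  le_antisymm x y hxy hyx := by
    rw [le_iff_zero_le_sub] at *
    exact (sub_eq_zero.1 (eq_zero_of_zero_le_of_zero_le_neg hxy (by rwa [neg_sub]))).symm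

instance : IsOrderedRing ((condReal A).obj ⊤) where
  add_le_add_left x y h z := by
    rw [le_iff_zero_le_sub] at *
    simpa using h
  zero_le_one := by simpa using zero_le_mul_self (1 : (condReal A).obj ⊤)
  mul_le_mul_of_nonneg_left z hz x y h := by
    rw [le_iff_zero_le_sub] at h ⊢
    rw [← mul_sub]
    exact zero_le_mul hz h
  mul_le_mul_of_nonneg_right z hz x y h := by
    rw [le_iff_zero_le_sub] at h ⊢
    rw [← sub_mul]
    exact zero_le_mul h hz

/-- The conditional real numbers are Archimedean. -/
theorem nonpos_of_forall_nsmul_le {x y : (condReal A).obj ⊤} (h : ∀ m : ℕ, m • x ≤ y) : x ≤ 0 := by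
  obtain ⟨p, rfl⟩ := mk_surjective x
  obtain ⟨q, rfl⟩ := mk_surjective y
  have h' : ∀ m : ℕ, 0 ≤ mk (q - m • p) := fun m => by
    have := le_iff_zero_le_sub.1 (h m)
    exact this
  rw [le_iff_zero_le_sub, zero_sub, show -mk p = mk (-p) from rfl, zero_le_mk_iff_denselyEventually]
  intro r hr c hc
  obtain ⟨d₁, hd₁, hb₁, M, hM, k₁, hk₁⟩ := exists_bound q hc
  -- With tolerance `1`, the hypothesis gives `m * u < v + 1 < M + 1 < m * r` for the values `u` of
  -- `p` and `v` of `q`, hence `u < r`.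
  obtain ⟨m, hm⟩ := exists_nat_gt ((M + 1) / r)
  have hm0 : (0 : ℚ) < m := lt_trans (by positivity) hm
  rw [div_lt_iff₀ hr] at hm
  obtain ⟨d₂, hd₂, hb₂, k₂, hk₂⟩ := zero_le_mk_iff_denselyEventually.1 (h' m) 1 one_pos d₁ hb₁
  refine ⟨d₂, hd₂.trans hd₁, hb₂, max k₁ k₂, fun j hj d hd h0 e he => ?_⟩
  obtain ⟨b₁, hbd₁, hb₁, u, hu, rfl⟩ := exists_of_le_coeff_map (- ·) h0 he
  obtain ⟨b, hbd, hb, v, hv⟩ := exists_dec (q.1 (pure A j)) hb₁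
  have hle := hbd.trans hbd₁
  have i₁ := abs_lt.1 (hk₁ j (by omega) b ((hle.trans hd).trans hd₂) hb v hv)
  have i₂ := hk₂ j (by omega) b (hle.trans hd) hb _ (le_coeff_sub hv (le_coeff_nsmul (hbd.trans hu) m))
  refine neg_lt_neg (lt_of_mul_lt_mul_left (a := (m : ℚ)) ?_ hm0.le)
  linarith [i₁.2]

end CondReal

/-! ### Conditional rationals inside the conditional reals: order, density and limits. -/

namespace CondReal

open Gen

universe u

variable {A : Type u} [CompleteBooleanAlgebra A]

variable (A) in
/-- The classical rationals as conditional rationals. -/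
def pureHom : ℚ →+* (gen A ℚ).obj ⊤ where
  toFun := pure A
  map_one' := rfl
  map_zero' := rfl
  map_add' r s := ext₃ (x := pure A r) (y := pure A r) (z := pure A r) fun c _ _ _ _ _ _ => ⟨r + s, le_coeff_pure _ _,
    le_coeff_map₂ (· + ·) (le_coeff_pure c r) (le_coeff_pure c s)⟩
  map_mul' r s := ext₃ (x := pure A r) (y := pure A r) (z := pure A r) fun c _ _ _ _ _ _ => ⟨r * s, le_coeff_pure _ _,
    le_coeff_map₂ (· * ·) (le_coeff_pure c r) (le_coeff_pure c s)⟩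

variable (A) in
/-- Constant conditional sequences. -/
def constSeq : (gen A ℚ).obj ⊤ →+* cauchySeq A where
  toFun x := ⟨fun _ => x, isCondSeq_iff.2 fun _ _ _ _ => rfl, isCauchy_const x⟩
  map_one' := rfl
  map_zero' := rfl
  map_add' _ _ := rfl
  map_mul' _ _ := rfl

variable (A) in
/-- The conditional rationals as conditional real numbers. -/
def ofGen : (gen A ℚ).obj ⊤ →+* (condReal A).obj ⊤ :=
  (Ideal.Quotient.mk (nullIdeal ⊤)).comp (constSeq A)

variable (A) in
/-- The classical rationals as conditional real numbers. -/
def ofRat : ℚ →+* (condReal A).obj ⊤ := (ofGen A).comp (pureHom A)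

theorem ofGen_eq_mk (x : (gen A ℚ).obj ⊤) : ofGen A x = mk (constSeq A x) := rfl

theorem ofGen_pure (r : ℚ) : ofGen A (pure A r) = ofRat A r := rfl

/-- The ring homomorphism `ofGen` is local. -/
theorem res_ofGen_congr {a : A} {x y : (gen A ℚ).obj ⊤}
    (h : (gen A ℚ).res a x = (gen A ℚ).res a y) :
    (condReal A).res a (ofGen A x) = (condReal A).res a (ofGen A y) := by
  refine Ideal.Quotient.eq.2 fun ε hε => ⟨pure A 0, fun n _ => ?_⟩
  rw [qabs_lt_iff]
  intro c hca hc e r he hr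
  obtain ⟨d, hdc, hd, u, hu⟩ := exists_dec x hc
  have hle := le_coeff_congr h (hdc.trans hca) hu
  rw [eq_of_le hd (hdc.trans he) (le_coeff_sub hu hle), sub_self, abs_zero]
  exact pos_iff.1 hε c hc r hr

/-- A conditional element partitions the top condition into the conditions on which it has a
classical value. -/
theorem isPartition_coeff {E : Type} [Nonempty E] (x : (gen A E).obj ⊤) :
    IsPartition ⊤ fun e : ULift.{u} E => coeff x e.down :=
  ⟨fun _ _ hij => x.2.1 fun h => hij (ULift.ext _ _ h),
    (Equiv.ulift.iSup_comp (g := coeff x)).trans x.2.2⟩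

/-- For constant sequences the values on a condition are fixed rationals, so an arbitrary tolerance
can be dropped. -/
theorem ofGen_le_ofGen {x y : (gen A ℚ).obj ⊤} : ofGen A x ≤ ofGen A y ↔ Rel (· ≤ ·) x y := by
  rw [le_iff_zero_le_sub, ← map_sub, ofGen_eq_mk, zero_le_mk_iff_denselyEventually, rel_iff]
  constructor
  · intro h c hc e e' he he'
    refine le_of_forall_pos_lt_add fun r hr => ?_
    obtain ⟨d, hdc, hd, k, hk⟩ := h r hr c hc
    have := hk k le_rfl d le_rfl hd _ (le_coeff_sub (hdc.trans he') (hdc.trans he))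
    linarith
  · intro h r hr c hc
    refine ⟨c, le_rfl, hc, 0, fun j _ d _ hd e he => ?_⟩
    obtain ⟨d₁, hd₁, hb₁, u, hu⟩ := exists_dec x hd
    obtain ⟨b, hb, hb0, v, hv⟩ := exists_dec y hb₁
    rw [eq_of_le hb0 ((hb.trans hd₁).trans he) (le_coeff_sub hv (hb.trans hu))]
    have := h b hb0 u v (hb.trans hu) hv
    linarith

theorem ofRat_le_ofRat_of_le {r s : ℚ} (h : r ≤ s) : ofRat A r ≤ ofRat A s := by
  rw [← ofGen_pure, ← ofGen_pure, ofGen_le_ofGen, rel_iff]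
  intro c hc e e' he he'
  rwa [eq_of_le hc he (le_coeff_pure c r), eq_of_le hc he' (le_coeff_pure c s)]

theorem ofRat_nonneg {r : ℚ} (h : 0 ≤ r) : 0 ≤ ofRat A r := by
  simpa using ofRat_le_ofRat_of_le (A := A) h

/-- The conditional rationals are dense in the conditional real numbers. -/
theorem exists_ofGen_near (x : (condReal A).obj ⊤) {r : ℚ} (hr : 0 < r) :
    ∃ y, ofGen A y - ofRat A r ≤ x ∧ x ≤ ofGen A y + ofRat A r := by
  obtain ⟨p, rfl⟩ := mk_surjective x
  obtain ⟨n₀, h⟩ := p.2.2 _ (pos_pure hr)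
  have key : ∀ c, c ≠ ⊥ → ∃ d ≤ c, d ≠ ⊥ ∧ ∃ k, ∀ j, k ≤ j → ∀ d' ≤ d, d' ≠ ⊥ → ∀ e e',
      d' ≤ coeff (p.1 (pure A j)) e → d' ≤ coeff (p.1 n₀) e' → |e - e'| < r := by
    intro c hc
    obtain ⟨d, hdc, hd, k, hk⟩ := exists_dec n₀ hc
    refine ⟨d, hdc, hd, k, fun j hj d' hd' h0 e e' he he' => ?_⟩
    obtain ⟨n, hle, hn⟩ := exists_rel_le hk hj
    exact qabs_sub_lt_iff.1 (h n n₀ hle rel_refl) d' h0 e e' r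
      (le_coeff_seq p (le_coeff_pure d' j) (hd'.trans hn) he) he' (le_coeff_pure d' r)
  -- The approximation is the term of the Cauchy sequence after which all terms stay within `r` of
  -- it.
  refine ⟨p.1 n₀, ?_, ?_⟩
  · rw [le_iff_zero_le_sub, ← ofGen_pure, ← map_sub, ofGen_eq_mk,
      show ∀ q, mk p - mk q = mk (p - q) from fun _ => rfl, zero_le_mk_iff_denselyEventually]
    intro s hs c hc
    obtain ⟨d, hdc, hd, k, hk⟩ := key c hc
    refine ⟨d, hdc, hd, k, fun j hj d' hd' h0 e he => ?_⟩
    obtain ⟨d₁, hd₁, hb₁, u, hu⟩ := exists_dec (p.1 (pure A j)) h0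
    obtain ⟨b, hb, hb0, v, hv⟩ := exists_dec (p.1 n₀) hb₁
    rw [eq_of_le hb0 ((hb.trans hd₁).trans he)
      (le_coeff_sub (hb.trans hu) (le_coeff_sub hv (le_coeff_pure b r)))]
    have := abs_lt.1 (hk j hj b ((hb.trans hd₁).trans hd') hb0 u v (hb.trans hu) hv)
    linarith [this.1]
  · rw [le_iff_zero_le_sub, ← ofGen_pure, ← map_add, ofGen_eq_mk,
      show ∀ q, mk q - mk p = mk (q - p) from fun _ => rfl, zero_le_mk_iff_denselyEventually]
    intro s hs c hc
    obtain ⟨d, hdc, hd, k, hk⟩ := key c hc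
    refine ⟨d, hdc, hd, k, fun j hj d' hd' h0 e he => ?_⟩
    obtain ⟨d₁, hd₁, hb₁, u, hu⟩ := exists_dec (p.1 (pure A j)) h0
    obtain ⟨b, hb, hb0, v, hv⟩ := exists_dec (p.1 n₀) hb₁
    rw [eq_of_le hb0 ((hb.trans hd₁).trans he)
      (le_coeff_sub (le_coeff_map₂ (· + ·) hv (le_coeff_pure b r)) (hb.trans hu))]
    have := abs_lt.1 (hk j hj b ((hb.trans hd₁).trans hd') hb0 u v (hb.trans hu) hv)
    linarith [this.2]

/-- Sequences of conditional rationals with a uniform Cauchy estimate converge. -/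
theorem exists_limit (x : ℕ → (gen A ℚ).obj ⊤)
    (hx : ∀ n m c, c ≠ ⊥ → ∀ e e', c ≤ coeff (x n) e → c ≤ coeff (x m) e' →
      e - 1 / ((n : ℚ) + 1) ≤ e') :
    ∃ z : (condReal A).obj ⊤, ∀ m, ofGen A (x m) - ofRat A (1 / ((m : ℚ) + 1)) ≤ z ∧
      z ≤ ofGen A (x m) := by
  -- The classical sequence is extended to conditional indices by gluing: `s n` is `x j` on the
  -- condition where `n` has the value `j`.
  choose s hs _ using fun n : (gen A ℕ).obj ⊤ => (gen A ℚ).stability _ (isPartition_coeff n)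
    fun j => (gen A ℚ).res _ (x j.down)
  have hval : ∀ {n : (gen A ℕ).obj ⊤} {c : A} {j : ℕ}, c ≤ coeff n j →
      (gen A ℚ).res c (s n) = (gen A ℚ).res c (x j) := fun {n c j} h =>
    (gen A ℚ).consistency h _ _ (hs n ⟨j⟩)
  have hseq : IsCondSeq s := by
    rw [isCondSeq_iff]
    intro a n m h
    rw [res_eq_iff]
    intro c hca hc e e' he he'
    obtain ⟨d, hdc, hd, j, hj⟩ := exists_dec n hc
    have hj' := le_coeff_congr h (hdc.trans hca) hj
    exact eq_of_le hd (le_coeff_congr (hval hj) le_rfl (hdc.trans he))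
      (le_coeff_congr (hval hj') le_rfl (hdc.trans he'))
  have hcau : IsCauchy s := by
    intro ε hε
    -- Where `ε` has the value `r`, indices `i ≥ 1 / r` satisfy `1 / (i + 1) < r`.
    refine ⟨map (fun r : ℚ => ⌈1 / r⌉₊) ε, fun m n hm hn => ?_⟩
    rw [qabs_sub_lt_iff]
    intro c hc e₁ e₂ r h₁ h₂ hr
    obtain ⟨d₁, hd₁, hb₁, i, hi⟩ := exists_dec m hc
    obtain ⟨d, hd, hb, j, hj⟩ := exists_dec n hb₁
    have hle := hd.trans hd₁
    have hi := hd.trans hi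
    have hr := hle.trans hr
    have h₁ := le_coeff_congr (hval hi) le_rfl (hle.trans h₁)
    have h₂ := le_coeff_congr (hval hj) le_rfl (hle.trans h₂)
    have hr0 := pos_iff.1 hε d hb r hr
    have small : ∀ i : ℕ, ⌈1 / r⌉₊ ≤ i → 1 / ((i : ℚ) + 1) < r := by
      intro i hi
      rw [one_div_lt (by positivity) hr0]
      exact (Nat.ceil_le.1 hi).trans_lt (lt_add_one _)
    have k₁ := small i (rel_iff.1 hm d hb _ i (le_coeff_map (fun r : ℚ => ⌈1 / r⌉₊) hr) hi)
    have k₂ := small j (rel_iff.1 hn d hb _ j (le_coeff_map (fun r : ℚ => ⌈1 / r⌉₊) hr) hj)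
    have l₁ := hx i j d hb _ _ h₁ h₂
    have l₂ := hx j i d hb _ _ h₂ h₁
    rw [abs_lt]
    constructor <;> linarith
  let p : cauchySeq A := ⟨s, hseq, hcau⟩
  have hp : ∀ {c : A} {j : ℕ} {e : ℚ}, c ≤ coeff (p.1 (pure A j)) e → c ≤ coeff (x j) e :=
    fun {c j e} h => le_coeff_congr (hval (le_coeff_pure c j)) le_rfl h
  refine ⟨mk p, fun m => ⟨?_, ?_⟩⟩
  · rw [le_iff_zero_le_sub, ← ofGen_pure, ← map_sub, ofGen_eq_mk,
      show ∀ q, mk p - mk q = mk (p - q) from fun _ => rfl, zero_le_mk_iff_denselyEventually]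
    intro r hr c hc
    refine ⟨c, le_rfl, hc, 0, fun j _ d _ hd e he => ?_⟩
    obtain ⟨d₁, hd₁, hb₁, u, hu⟩ := exists_dec (p.1 (pure A j)) hd
    obtain ⟨b, hb, hb0, v, hv⟩ := exists_dec (x m) hb₁
    rw [eq_of_le hb0 ((hb.trans hd₁).trans he)
      (le_coeff_sub (hb.trans hu) (le_coeff_sub hv (le_coeff_pure b (1 / ((m : ℚ) + 1)))))]
    have := hx m j b hb0 v u hv (hp (hb.trans hu))
    linarith
  · rw [le_iff_zero_le_sub, ofGen_eq_mk,
      show ∀ q, mk q - mk p = mk (q - p) from fun _ => rfl, zero_le_mk_iff_denselyEventually]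
    intro r hr c hc
    -- The hypothesis `hx j m` puts `x j` below `x m` up to the error `1 / (j + 1)`, which vanishes
    -- in the limit; so `z ≤ x m` holds with no error term.
    obtain ⟨k, hk⟩ := exists_nat_one_div_lt hr
    refine ⟨c, le_rfl, hc, k, fun j hj d _ hd e he => ?_⟩
    obtain ⟨d₁, hd₁, hb₁, u, hu⟩ := exists_dec (p.1 (pure A j)) hd
    obtain ⟨b, hb, hb0, v, hv⟩ := exists_dec (x m) hb₁
    rw [eq_of_le hb0 ((hb.trans hd₁).trans he) (le_coeff_sub hv (hb.trans hu))]
    have h1 := hx j m b hb0 u v (hp (hb.trans hu)) hv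
    have h2 : 1 / ((j : ℚ) + 1) ≤ 1 / ((k : ℚ) + 1) := by
      have : (k : ℚ) ≤ j := by exact_mod_cast hj
      gcongr
    linarith

end CondReal

/-! ### Order completeness. -/

namespace CondReal

open Gen

universe u

variable {A : Type u} [CompleteBooleanAlgebra A]

/-- A non-empty bounded set of conditional rationals has an upper bound which exceeds any other
upper bound by at most `δ`. -/
theorem exists_near_least_upper_bound {T : Set ((gen A ℚ).obj ⊤)} (hT : T.Nonempty)
    {B : (gen A ℚ).obj ⊤} (hB : ∀ y ∈ T, Rel (· ≤ ·) y B) {δ : ℚ} (hδ : 0 < δ) :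
    ∃ x : (gen A ℚ).obj ⊤, (∀ y ∈ T, Rel (· ≤ ·) y x) ∧
      ∀ z : (gen A ℚ).obj ⊤, (∀ y ∈ T, Rel (· ≤ ·) y z) → ∀ c, c ≠ ⊥ → ∀ e e',
        c ≤ coeff x e → c ≤ coeff z e' → e - δ ≤ e' := by
  let UB : A → ℚ → Prop := fun c q => ∀ y ∈ T, ∀ d ≤ c, d ≠ ⊥ → ∀ e, d ≤ coeff y e → e ≤ q
  have UB_mono : ∀ {c d q}, d ≤ c → UB c q → UB d q := fun {c d q} hdc h y hy b hb =>
    h y hy b (hb.trans hdc)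
  have UB_le : ∀ {c q r}, q ≤ r → UB c q → UB c r := fun {c q r} hqr h y hy b hb hb0 e he =>
    (h y hy b hb hb0 e he).trans hqr
  have UB_of_rel : ∀ {z : (gen A ℚ).obj ⊤}, (∀ y ∈ T, Rel (· ≤ ·) y z) → ∀ {c q},
      c ≤ coeff z q → UB c q := fun {z} hz {c q} hq y hy d hd hd0 e he =>
    rel_iff.1 (hz y hy) d hd0 e q he (hd.trans hq)
  -- Near-minimality is demanded on all non-zero smaller conditions, so that the selected property
  -- is hereditary.
  obtain ⟨x, hx⟩ := exists_selection (A := A) (E := ℚ)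
    (fun c q => UB c q ∧ ∀ d ≤ c, d ≠ ⊥ → ¬ UB d (q - δ))
    (fun c d q hdc h => ⟨UB_mono hdc h.1, fun b hb => h.2 b (hb.trans hdc)⟩)
    (by
      intro c hc
      obtain ⟨y, hy⟩ := hT
      obtain ⟨d₁, hd₁, hb₁, b, hb⟩ := exists_dec B hc
      obtain ⟨d₂, hd₂, hb₂, v, hv⟩ := exists_dec y hb₁
      -- The least `k` is taken over all non-zero parts of `d₂` at once, so its minimality survives
      -- further shrinking. It is not `0`, because `v - 1` is below the value `v` of `y ∈ T`.
      have hex : ∃ k : ℕ, ∃ d ≤ d₂, d ≠ ⊥ ∧ UB d (v - 1 + k * δ) := by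
        obtain ⟨k, hk⟩ := exists_nat_ge ((b - (v - 1)) / δ)
        rw [div_le_iff₀ hδ] at hk
        exact ⟨k, d₂, le_rfl, hb₂, UB_le (by linarith) (UB_of_rel hB (hd₂.trans hb))⟩
      classical
      obtain ⟨d, hd, hd0, hU⟩ := Nat.find_spec hex
      have hmin := fun m => Nat.find_min hex (m := m)
      generalize Nat.find hex = k at hU hmin
      refine ⟨d, (hd.trans hd₂).trans hd₁, hd0, _, hU, fun d' hd' h0 hU' => ?_⟩
      cases k with
      | zero =>
        have := hU y hy d le_rfl hd0 v (hd.trans hv)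
        norm_num at this
      | succ k =>
        refine hmin k k.lt_succ_self ⟨d', hd'.trans hd, h0, ?_⟩
        convert hU' using 1
        push_cast
        ring)
  refine ⟨x, fun y hy => ?_, fun z hz c hc e e' he he' => ?_⟩
  · rw [rel_iff]
    intro c hc e e' he he'
    obtain ⟨d, hdc, hd, h, -⟩ := hx c hc e' he'
    exact h y hy d le_rfl hd e (hdc.trans he)
  · obtain ⟨d, hdc, hd, -, h⟩ := hx c hc e he
    by_contra! hlt
    exact h d le_rfl hd (UB_le hlt.le (UB_of_rel hz (hdc.trans he')))

theorem nsmul_ofRat_one_div (m : ℕ) : (m + 1) • ofRat A (1 / ((m : ℚ) + 1)) = 1 := by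
  rw [← map_nsmul, nsmul_eq_mul, Nat.cast_succ, mul_one_div_cancel (by positivity), map_one]

/-- Inequalities between conditional real numbers may be proved up to small rational errors. -/
theorem le_of_forall_le_add {x y z : (condReal A).obj ⊤}
    (h : ∀ m : ℕ, x ≤ y + ofRat A (1 / ((m : ℚ) + 1)) * z) : x ≤ y := by
  rw [← sub_nonpos]
  -- The hypothesis gives `(m + 1) • (x - y) ≤ z`. The bound `z * z + 1` dominates `z` and is also
  -- non-negative, as the multiple `0` requires.
  refine nonpos_of_forall_nsmul_le (y := z * z + 1) fun m => ?_
  have hz : 0 ≤ z * z - z + 1 := by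
    have h1 := zero_le_mul_self (z - ofRat A (1 / 2))
    have h2 : (z - ofRat A (1 / 2)) * (z - ofRat A (1 / 2)) = z * z - z + ofRat A (1 / 4) := by
      have h3 : ofRat A (1 / 2) + ofRat A (1 / 2) = 1 := by rw [← map_add]; norm_num
      have h4 : ofRat A (1 / 2) * ofRat A (1 / 2) = ofRat A (1 / 4) := by rw [← map_mul]; norm_num
      linear_combination h4 - z * h3
    rw [h2] at h1
    have h5 : ofRat A (1 / 4) ≤ 1 := by
      simpa using ofRat_le_ofRat_of_le (A := A) (show (1 / 4 : ℚ) ≤ 1 by norm_num)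
    exact h1.trans (add_le_add_right h5 _)
  cases m with
  | zero => simpa using add_nonneg (zero_le_mul_self z) zero_le_one
  | succ m =>
    have h1 := nsmul_le_nsmul_right (sub_le_iff_le_add'.2 (h m)) (m + 1)
    rw [← smul_mul_assoc, nsmul_ofRat_one_div, one_mul] at h1
    refine h1.trans ?_
    rw [← sub_nonneg]
    exact hz.trans_eq (by ring)

/-- Non-empty bounded sets of conditional real numbers have suprema. -/
theorem exists_isLUB {S : Set ((condReal A).obj ⊤)} (hS : S.Nonempty) (hbdd : BddAbove S) :
    ∃ a, IsLUB S a := by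
  let T : Set ((gen A ℚ).obj ⊤) := {y | ∃ s ∈ S, ofGen A y ≤ s}
  have hT : T.Nonempty := by
    obtain ⟨s, hs⟩ := hS
    obtain ⟨y, hy, -⟩ := exists_ofGen_near s one_pos
    exact ⟨y - pure A 1, s, hs, by rwa [map_sub, ofGen_pure]⟩
  -- Upper bounds of `S` correspond to conditional rational upper bounds of `T` up to small errors,
  -- so the supremum can be sought for `T`.
  have hTS : ∀ b ∈ upperBounds S, ∀ {r : ℚ}, 0 < r → ∃ z, (∀ y ∈ T, Rel (· ≤ ·) y z) ∧
      ofGen A z ≤ b + ofRat A (2 * r) := by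
    intro b hb r hr
    obtain ⟨z, hz, hz'⟩ := exists_ofGen_near b hr
    refine ⟨z + pure A r, ?_, ?_⟩
    · rintro y ⟨s, hs, hys⟩
      rw [← ofGen_le_ofGen, map_add, ofGen_pure]
      exact (hys.trans (hb hs)).trans hz'
    · rw [map_add, ofGen_pure, two_mul, map_add, ← add_assoc]
      exact add_le_add_left (sub_le_iff_le_add.1 hz) _
  obtain ⟨b, hb⟩ := hbdd
  obtain ⟨B, hB, -⟩ := hTS b hb one_pos
  have hδ : ∀ n : ℕ, 0 < 1 / ((n : ℚ) + 1) := fun n => by positivity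
  choose x hx hx' using fun n : ℕ => exists_near_least_upper_bound hT hB (hδ n)
  -- Every `x m` is itself an upper bound of `T`, so near-minimality of `x n` is exactly the
  -- required Cauchy estimate.
  obtain ⟨a, ha⟩ := exists_limit x fun n m => hx' n _ (hx m)
  refine ⟨a, fun s hs => ?_, fun b hb => ?_⟩
  · refine le_of_forall_le_add (z := 1 + 1 + 1) fun m => ?_
    obtain ⟨y, hy, hy'⟩ := exists_ofGen_near s (hδ m)
    have h1 : y - pure A (1 / ((m : ℚ) + 1)) ∈ T := ⟨s, hs, by rwa [map_sub, ofGen_pure]⟩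
    have h2 := ofGen_le_ofGen.2 (hx m _ h1)
    rw [map_sub, ofGen_pure, sub_le_iff_le_add] at h2
    have h3 := sub_le_iff_le_add.1 (ha m).1
    refine hy'.trans ((add_le_add_left (h2.trans (add_le_add_left h3 _)) _).trans_eq ?_)
    ring
  · refine le_of_forall_le_add (z := 1 + 1 + 1) fun m => ?_
    obtain ⟨z, hz, hz'⟩ := hTS b hb (hδ m)
    have h1 : Rel (· ≤ ·) (x m - pure A (1 / ((m : ℚ) + 1))) z := by
      rw [rel_iff]
      intro c hc e e' he he'
      obtain ⟨d, hdc, hd, u, hu⟩ := exists_dec (x m) hc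
      rw [eq_of_le hd (hdc.trans he) (le_coeff_sub hu (le_coeff_pure d _))]
      exact hx' m z hz d hd u e' hu (hdc.trans he')
    have h2 := ofGen_le_ofGen.2 h1
    rw [map_sub, ofGen_pure, sub_le_iff_le_add] at h2
    refine (((ha m).2.trans h2).trans (add_le_add_left hz' _)).trans_eq ?_
    rw [two_mul, map_add]
    ring

end CondReal

/-! ### Locality and full linearity from domination. -/

namespace CondReal

open Gen

universe u v

variable {A : Type u} [CompleteBooleanAlgebra A]

theorem isPartition_compl (a : A) :
    IsPartition ⊤ fun i : ULift.{u} Bool => if i.down then a else aᶜ := by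
  refine ⟨?_, ?_⟩
  · rintro ⟨i⟩ ⟨j⟩ hij
    cases i <;> cases j <;> simp_all [disjoint_compl_right, disjoint_compl_left]
  · rw [eq_top_iff, ← sup_compl_eq_top (x := a)]
    exact sup_le (le_iSup (fun i : ULift.{u} Bool => if i.down then a else aᶜ) ⟨true⟩)
      (le_iSup (fun i : ULift.{u} Bool => if i.down then a else aᶜ) ⟨false⟩)

/-- The restriction to a condition as a ring homomorphism. -/
def resHom (a : A) : (condReal A).obj ⊤ →+* (condReal A).obj a :=
  Ideal.Quotient.factor (nullIdeal_anti le_top)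

theorem res_eq_resHom (a : A) (x : (condReal A).obj ⊤) : (condReal A).res a x = resHom a x := rfl

theorem eq_of_resHom_eq {a : A} {x y : (condReal A).obj ⊤} (h : resHom a x = resHom a y)
    (h' : resHom aᶜ x = resHom aᶜ y) : x = y := by
  refine ((condReal A).stability _ (isPartition_compl a) fun i => (condReal A).res _ y).unique
    ?_ fun _ => rfl
  rintro ⟨i⟩
  cases i
  · exact h'
  · exact h

/-- Glue `1` on `a` with `0` on `aᶜ`. The result is idempotent, hence a square and non-negative, and
multiplying by it erases everything off `a`. -/
theorem exists_indicator (a : A) : ∃ e : (condReal A).obj ⊤, 0 ≤ e ∧ resHom a e = 1 ∧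
    ∀ x y, resHom a x = resHom a y → e * x = e * y := by
  obtain ⟨e, he, -⟩ := (condReal A).stability _ (isPartition_compl a)
    fun i => (condReal A).res _ (if i.down then 1 else 0)
  have h1 : resHom a e = 1 := (he ⟨true⟩).trans (map_one (resHom a))
  have h0 : resHom aᶜ e = 0 := (he ⟨false⟩).trans (map_zero (resHom aᶜ))
  have hee : e * e = e := eq_of_resHom_eq (a := a) (by simp [h1]) (by simp [h0])
  refine ⟨e, hee ▸ zero_le_mul_self e, h1, fun x y h => eq_of_resHom_eq (a := a) ?_ ?_⟩
  · simp [h]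
  · simp [h0]

/-- An additive function dominated by a local function is local. -/
theorem resHom_eq_zero_of_le {X : Type*} [AddCommGroup X] {k : X → (condReal A).obj ⊤}
    {g : X →+ (condReal A).obj ⊤} (hgk : ∀ x, g x ≤ k x) {a : A} {x : X}
    (hx : ∀ n : ℤ, resHom a (k (n • x)) = resHom a (k 0)) : resHom a (g x) = 0 := by
  obtain ⟨e, he, he1, hloc⟩ := exists_indicator a
  -- The indicator replaces `k (n • x)` by `k 0`, so the bound does not depend on `n`; negative `n`
  -- supply the opposite inequality.
  have key : ∀ n : ℤ, n • (e * g x) ≤ e * k 0 := by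
    intro n
    rw [← hloc _ _ (hx n), ← mul_smul_comm, ← map_zsmul]
    exact mul_le_mul_of_nonneg_left (hgk _) he
  have h1 : e * g x ≤ 0 := nonpos_of_forall_nsmul_le fun m => by
    simpa only [natCast_zsmul] using key m
  have h2 : -(e * g x) ≤ 0 := nonpos_of_forall_nsmul_le (y := e * k 0) fun m => by
    simpa only [neg_zsmul, natCast_zsmul, smul_neg] using key (-m)
  have h3 : e * g x = 0 := le_antisymm h1 (neg_nonpos.1 h2)
  have h4 := congrArg (resHom a) h3
  rwa [map_mul, he1, one_mul, map_zero] at h4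

theorem ofRat_half_mul_two (x : (condReal A).obj ⊤) : ofRat A (1 / 2) * (2 * x) = x := by
  have h : ofRat A (1 / 2) * 2 = 1 := by rw [← map_ofNat (ofRat A) 2, ← map_mul]; norm_num
  rw [← mul_assoc, h, one_mul]

/-- Twice the difference is `(x - 1) ^ 2 + x ^ 2 + 1`. Sums of such non-negative bounds dominate
several elements at once, without maxima. -/
theorem le_mul_self_add_one (x : (condReal A).obj ⊤) : x ≤ x * x + 1 := by
  have h2 : 0 ≤ (x - 1) * (x - 1) + x * x + 1 :=
    add_nonneg (add_nonneg (zero_le_mul_self _) (zero_le_mul_self _)) zero_le_one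
  have h := mul_nonneg (ofRat_nonneg (A := A) (show (0 : ℚ) ≤ 1 / 2 by norm_num)) h2
  rw [show (x - 1) * (x - 1) + x * x + 1 = 2 * (x * x + 1 - x) by ring, ofRat_half_mul_two] at h
  exact sub_nonneg.1 h

section Module

variable {X : Type v} [AddCommGroup X] [Module ((condReal A).obj ⊤) X]

/-- The Hahn-Banach theorem over the classical rationals. -/
theorem exists_ratLinear_extension {k : X → (condReal A).obj ⊤}
    (hk : ∀ (x y : X) (l : (condReal A).obj ⊤), 0 ≤ l → l ≤ 1 →
      k (l • x + (1 - l) • y) ≤ l * k x + (1 - l) * k y)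
    (Y : Submodule ((condReal A).obj ⊤) X) (f : Y →ₗ[(condReal A).obj ⊤] (condReal A).obj ⊤)
    (hf : ∀ y : Y, f y ≤ k y) : ∃ g : X →+ (condReal A).obj ⊤, (∀ x, g x ≤ k x) ∧
      (∀ y : Y, g y = f y) ∧ ∀ (r : ℚ) x, g (ofRat A r • x) = ofRat A r * g x := by
  -- Restricting scalars along `ofRat` makes `ℚ` the ground field; conditional convexity is then
  -- used only for rational weights.
  let _ : Module ℚ X := Module.compHom X (ofRat A)
  let _ : Module ℚ ((condReal A).obj ⊤) := Module.compHom _ (ofRat A)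
  have : PosSMulMono ℚ ((condReal A).obj ⊤) :=
    ⟨fun r hr x y h => mul_le_mul_of_nonneg_left h (ofRat_nonneg hr)⟩
  have hconv : ConvexOn ℚ Set.univ k := by
    refine ⟨convex_univ, fun x _ y _ a b ha hb hab => ?_⟩
    obtain rfl : b = 1 - a := by linarith
    have h := hk x y (ofRat A a) (ofRat_nonneg ha) (by
      simpa using ofRat_le_ofRat_of_le (A := A) (show a ≤ 1 by linarith))
    rwa [← map_one (ofRat A), ← map_sub] at h
  let p : X →ₗ.[ℚ] (condReal A).obj ⊤ :=
    { domain :=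
        { carrier := Y
          add_mem' := Y.add_mem
          zero_mem' := Y.zero_mem
          smul_mem' := fun r _ h => Y.smul_mem (ofRat A r) h }
      toFun :=
        { toFun := fun y => f ⟨y.1, y.2⟩
          map_add' := fun x y => f.map_add ⟨x.1, x.2⟩ ⟨y.1, y.2⟩
          map_smul' := fun r x => f.map_smul (ofRat A r) ⟨x.1, x.2⟩ } }
  obtain ⟨g, hgk, hg⟩ := p.exists_extension_of_le_convex (fun S => exists_isLUB) hconv
    fun y => hf ⟨y.1, y.2⟩
  exact ⟨g.toAddMonoidHom, hgk, fun y => hg ⟨y.1, y.2⟩, fun r x => g.map_smul r x⟩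

/-- An additive function with a convex majorant is linear if it is linear for the conditional
rationals. -/
theorem map_smul_of_map_ofGen_smul {k : X → (condReal A).obj ⊤}
    (hk : ∀ (x y : X) (l : (condReal A).obj ⊤), 0 ≤ l → l ≤ 1 →
      k (l • x + (1 - l) • y) ≤ l * k x + (1 - l) * k y)
    {g : X →+ (condReal A).obj ⊤} (hgk : ∀ x, g x ≤ k x) {x : X}
    (hg : ∀ q, g (ofGen A q • x) = ofGen A q * g x) (l : (condReal A).obj ⊤) :
    g (l • x) = l * g x := by
  -- The defect of homogeneity at `x`: additive in the scalar, and zero on conditional rationals by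
  -- `hg`.
  let h : (condReal A).obj ⊤ →+ (condReal A).obj ⊤ :=
    { toFun := fun l => g (l • x) - l * g x
      map_zero' := by simp
      map_add' := fun l m => by rw [add_smul, map_add]; ring }
  have h_apply : ∀ l, h l = g (l • x) - l * g x := fun _ => rfl
  -- For `d` in `[-1, 1]` the weight `t = (1 + d) / 2` lies in `[0, 1]` and `t - (1 - t) = d`. So `d
  -- • x` is a convex combination of `x` and `-x`.
  have combo : ∀ {d u v N : (condReal A).obj ⊤}, -1 ≤ d → d ≤ 1 → u ≤ N → v ≤ N →
      ofRat A (1 / 2) * (1 + d) * u + (1 - ofRat A (1 / 2) * (1 + d)) * v ≤ N ∧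
      0 ≤ ofRat A (1 / 2) * (1 + d) ∧ ofRat A (1 / 2) * (1 + d) ≤ 1 := by
    intro d u v N h1 h2 hu hv
    have hhalf : 0 ≤ ofRat A (1 / 2) := ofRat_nonneg (by norm_num)
    have t0 : 0 ≤ ofRat A (1 / 2) * (1 + d) := mul_nonneg hhalf (neg_le_iff_add_nonneg'.1 h1)
    have t1 : ofRat A (1 / 2) * (1 + d) ≤ 1 := by
      have h3 := mul_le_mul_of_nonneg_left (add_le_add_right h2 1) hhalf
      rwa [show (1 : (condReal A).obj ⊤) + 1 = 2 * 1 by ring, ofRat_half_mul_two] at h3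
    refine ⟨?_, t0, t1⟩
    refine (add_le_add (mul_le_mul_of_nonneg_left hu t0)
      (mul_le_mul_of_nonneg_left hv (sub_nonneg.2 t1))).trans_eq ?_
    ring
  have double : ∀ d : (condReal A).obj ⊤,
      ofRat A (1 / 2) * (1 + d) - (1 - ofRat A (1 / 2) * (1 + d)) = d := by
    intro d
    have := ofRat_half_mul_two (1 + d)
    linear_combination this
  obtain ⟨C, hC⟩ : ∃ C, ∀ d, -1 ≤ d → d ≤ 1 → h d ≤ C := by
    -- The first two terms dominate `k x` and `k (-x)`, hence `g (d • x)` by convexity; the last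
    -- dominates `±g x`, hence `-(d * g x)`.
    refine ⟨(k x * k x + 1) + (k (-x) * k (-x) + 1) + (g x * g x + 1), fun d h1 h2 => ?_⟩
    have hpos : ∀ y : (condReal A).obj ⊤, 0 ≤ y * y + 1 :=
      fun y => add_nonneg (zero_le_mul_self y) zero_le_one
    obtain ⟨h3, h4, h5⟩ := combo h1 h2
      ((le_mul_self_add_one (k x)).trans (le_add_of_nonneg_right (hpos (k (-x)))))
      ((le_mul_self_add_one (k (-x))).trans (le_add_of_nonneg_left (hpos (k x))))
    have h6 := hk x (-x) _ h4 h5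
    rw [smul_neg, ← sub_eq_add_neg, ← sub_smul, double] at h6
    obtain ⟨h7, -, -⟩ := combo (u := -g x) (v := g x) (N := g x * g x + 1) h1 h2
      (by simpa using le_mul_self_add_one (-g x)) (le_mul_self_add_one (g x))
    have h8 : -(d * g x) ≤ g x * g x + 1 := by
      refine le_of_eq_of_le ?_ h7
      linear_combination (g x) * double d
    rw [h_apply, sub_eq_add_neg]
    exact add_le_add ((hgk _).trans (h6.trans h3)) h8
  have key : ∀ l, h l ≤ 0 := by
    intro l
    have hC0 : 0 ≤ C := by simpa using hC 0 (by simp) zero_le_one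
    refine nonpos_of_forall_nsmul_le (y := C) fun m => ?_
    cases m with
    | zero => simpa using hC0
    | succ m =>
      -- Subtracting `q` does not change `h`, and `(m + 1) • (l - q)` lies in `[-1, 1]`; hence `(m +
      -- 1) • h l ≤ C`.
      obtain ⟨q, hq₁, hq₂⟩ := exists_ofGen_near l (r := 1 / ((m : ℚ) + 1)) (by positivity)
      have h1 : h l = h (l - ofGen A q) := by
        rw [map_sub, h_apply (ofGen A q), hg, sub_self, sub_zero]
      have h2 := nsmul_le_nsmul_right (sub_le_iff_le_add'.2 hq₂) (m + 1)
      have h3 := nsmul_le_nsmul_right (neg_le_sub_iff_le_add.2 (sub_le_iff_le_add.1 hq₁)) (m + 1)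
      rw [nsmul_ofRat_one_div] at h2
      rw [smul_neg, nsmul_ofRat_one_div] at h3
      rw [h1, ← map_nsmul]
      exact hC _ h3 h2
  have h1 : h l = 0 := le_antisymm (key l) (by simpa using key (-l))
  exact sub_eq_zero.1 h1

end Module

end CondReal

/-! ### Local operations and assembly of the conditional extension. -/

theorem CondModule.res_smul_congr.{u, v, w} {A : Type u} [CompleteBooleanAlgebra A]
    {K : CondSet.{u, w} A} [CondRing K] {X : CondSet.{u, v} A} [CondModule K X] {a : A}
    {l m : K.obj ⊤} {x y : X.obj ⊤} (hl : K.res a l = K.res a m) (hx : X.res a x = X.res a y) :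
    X.res a (l • x) = X.res a (m • y) := by
  obtain ⟨F, hF⟩ := CondModule.smul_cond (K := K) (X := X)
  rw [← hF, ← hF]
  exact F.congr_res a (Prod.ext hl hx)

theorem CondModule.res_add_congr.{u, v, w} {A : Type u} [CompleteBooleanAlgebra A]
    (K : CondSet.{u, w} A) [CondRing K] {X : CondSet.{u, v} A} [CondModule K X] {a : A}
    {x y x' y' : X.obj ⊤} (hx : X.res a x = X.res a y) (hx' : X.res a x' = X.res a y') :
    X.res a (x + x') = X.res a (y + y') := by
  obtain ⟨F, hF⟩ := CondModule.add_cond (K := K) (X := X)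
  rw [← hF, ← hF]
  exact F.congr_res a (Prod.ext hx hx')

open CondReal Gen in
theorem mainTheorem5 {A : Type*} [CompleteBooleanAlgebra A] [Nontrivial A]
    (X : CondSet A) [CondModule (condReal A) X]
    (k : CondFun X (condReal A)) (hk : IsCondConvex k)
    (Y : CondSubspace (condReal A) X)
    (f : CondFun Y.toCondSet (condReal A)) (hf : IsCondLinear f)
    (hfk : ∀ y : Y.toCondSet.obj ⊤, f y ≤ k y.1) :
    ∃ g : CondFun X (condReal A), IsCondLinear g ∧ (∀ x : X.obj ⊤, g x ≤ k x) ∧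
      ∀ y : Y.toCondSet.obj ⊤, g y.1 = f y := by
  obtain ⟨g, hgk, hgf, hgr⟩ := exists_ratLinear_extension (k := k) hk Y.toSubmodule
    { toFun := f, map_add' := hf.1, map_smul' := hf.2 } hfk
  have hloc : ∀ a x y, X.res a x = X.res a y →
      (condReal A).res a (g x) = (condReal A).res a (g y) := by
    intro a x y h
    have h0 : X.res a (x - y) = X.res a 0 := by
      rw [sub_eq_add_neg, ← add_neg_cancel y]
      exact CondModule.res_add_congr (condReal A) h rfl
    -- On `a` the element `x - y` is zero, hence so are its integer multiples, and the conditional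
    -- function `k` cannot tell them from `0` there.
    have h1 : resHom a (g (x - y)) = 0 := resHom_eq_zero_of_le hgk fun n => by
      refine k.congr_res a ?_
      have := CondModule.res_smul_congr (K := condReal A) (l := (n : (condReal A).obj ⊤)) rfl h0
      rwa [smul_zero, Int.cast_smul_eq_zsmul] at this
    rw [map_sub, map_sub] at h1
    exact sub_eq_zero.1 h1
  have hgen : ∀ q x, g (ofGen A q • x) = ofGen A q * g x := by
    intro q x
    -- Both sides are compared on the pieces where `q` has a classical value `r`; there locality of
    -- `g` allows replacing `q` by `r`, and uniqueness of gluing finishes.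
    refine ((condReal A).stability _ (isPartition_coeff q) fun i => (condReal A).res _
      (ofGen A q * g x)).unique (fun ⟨r⟩ => ?_) fun _ => rfl
    have hr : (condReal A).res (coeff q r) (ofGen A q) = (condReal A).res (coeff q r) (ofRat A r) :=
      res_ofGen_congr (res_eq_of_le_coeff le_rfl (le_coeff_pure _ r))
    rw [hloc _ _ _ (CondModule.res_smul_congr (K := condReal A) hr (x := x) rfl), hgr,
      res_eq_resHom, res_eq_resHom, map_mul, map_mul]
    exact congrArg (· * _) hr.symm
  refine ⟨CondFun.ofPrimal g hloc, ⟨fun x y => ?_, fun l x => ?_⟩, fun x => ?_, fun y => ?_⟩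
  · simp only [CondFun.ofPrimal_apply]
    exact map_add g x y
  · simp only [CondFun.ofPrimal_apply]
    exact map_smul_of_map_ofGen_smul hk hgk (fun q => hgen q x) l
  · rw [CondFun.ofPrimal_apply]
    exact hgk x
  · rw [CondFun.ofPrimal_apply]
    exact hgf y
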